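/- **Model.** For every $n\ge1$ one observes $y_i^n=n\int_{[i/n,(i+1)/n)}f(x)\,dx+\xi_i^n$, $i=0,\dots,n-1$, where for each $n$ the $\xi_0^n,\dots,\xi_{n-1}^n$ are independent and sub-Gaussian with scale $\sigma\ge 0$, i.e. $E e^{u\xi_i^n}\le e^{u^2\sigma^2/2}$ for all $u\in\mathbb R$, and $f$ is càdlàg on $[0,1)$. Let $\mathcal S$ be the set of right-continuous step functions on $[0,1)$ with finitely many jumps, $J(g)$ the set of jump locations of $g\in\mathcal S$, and $\mathcal S_n=\{g\in\mathcal S: J(g)\subset\{i/n:0\le i\le n\}\}$. For $0<q\le\infty$, $\gamma,L>0$ let $\Delta_{q,k}(f)=\inf\{\|f-g\|_{L^q}: g\in\mathcal S,\ \#J(g)\le k\}$ and $$\mathcal A^\gamma_{q,L}=\Bigl\{f \text{ càdlàg on }[0,1):\ \sup_{k\ge1}k^\gamma\Delta_{q,k}(f)\le L,\ \|f\|_{L^\infty}\le L\Bigr\}.$$ **Estimator.** Let $c>1$ and $\delta>0$, and for all large $n$ let $\mathcal I=\mathcal I_n$ be a $c$-normal system of intervals $[u,v)\subseteq[0,1)$: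 (i) every interval $I=[u,v)\subseteq[0,1)$ with $|I|>c/n$ contains some $\tilde I\in\mathcal I$ with $|\tilde I|\ge c^{-1}|I|$; (ii) all end-points of intervals in $\mathcal I$ lie in $\{i/n:0\le i\le n\}$; (iii) $[i/n,(i+1)/n)\in\mathcal I$ for $0\le i<n$. Let $s_I\in\mathbb R$ be scale penalties, possibly random and depending on the data and on the candidate $g$, with $\sup_{I\in\mathcal I}|s_I|\le\delta\sqrt{\log n}$ almost surely, for all candidates and all large $n$. A multiscale change-point segmentation estimator $\hat f_n$ with threshold $\eta$ is any (almost sure) solution of $$\min_{g\in\mathcal S_n}\#J(g)\quad\text{subject to}\quad \sup_{\substack{I\in\mathcal I\\ g\equiv c_I\text{ on }I}}\Bigl\{\frac1{\sqrt{n|I|}}\Bigl|\sum_{i/n\in I}(y_i^n-c_I)\Bigr|-s_I\Bigr\}\le\eta .$$ **Theorem.** Let $0<p,r<\infty$, $\max\{p,2\}\le q\le\infty$, $\gamma,L>0$, and let $\hat f_n$ be a multiscale change-point segmentation estimator with constants $c,\delta$ and threshold $\eta=a\sqrt{\log n}$ for some $a>\delta+\sigma\sqrt{2r+4}$. Then $$\limsup_{n\to\infty}\,(\log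 n)^{-\frac{\gamma+(1/2-1/p)_+}{2\gamma+1}}\,n^{\frac{2\gamma}{2\gamma+1}\min\{1/2,1/p\}}\sup_{f\in\mathcal A^\gamma_{q,L}}\Bigl(E\bigl\|\hat f_n-f\bigr\|_{L^p}^r\Bigr)^{1/r}<\infty .$$ Moreover, if the almost sure requirements on $s_I$ and $\hat f_n$ hold outside a null set that is common to all $f\in\mathcal A^\gamma_{q,L}$, then almost surely $$\limsup_{n\to\infty}\,(\log n)^{-\frac{\gamma+(1/2-1/p)_+}{2\gamma+1}}\,n^{\frac{2\gamma}{2\gamma+1}\min\{1/2,1/p\}}\sup_{f\in\mathcal A^\gamma_{q,L}}\bigl\|\hat f_n-f\bigr\|_{L^p}<\infty .$$ -/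

import Mathlib

open Set Filter Topology MeasureTheory ProbabilityTheory
open scoped ENNReal NNReal

noncomputable section

namespace MultiscaleSeg

/-- Lebesgue measure on `[0,1)`. Signals are functions `ℝ → ℝ` of which only the values on
`[0,1)` matter. -/
def unitMeasure : Measure ℝ := volume.restrict (Ico (0 : ℝ) 1)

/-- The (quasi-)norm of `L^p([0,1))`, for `0 < p ≤ ∞`, with values in `[0,∞]`. -/
def lpNorm (f : ℝ → ℝ) (p : ℝ≥0∞) : ℝ≥0∞ := eLpNorm f p unitMeasure

/-- Càdlàg functions on `[0,1)`: right-continuous, with left-sided limits. -/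
def IsCadlag (f : ℝ → ℝ) : Prop :=
  (∀ x ∈ Ico (0 : ℝ) 1, ContinuousWithinAt f (Ici x) x) ∧
    ∀ x ∈ Ioo (0 : ℝ) 1, ∃ l : ℝ, Tendsto f (𝓝[<] x) (𝓝 l)

/-- Right-continuous step functions on `[0,1)` with `k` jumps for some finite `k`:
`∑ c_i 1_{[τ_i, τ_{i+1})}` with `0 = τ_0 < ⋯ < τ_{k+1} = 1` and `c_i ≠ c_{i+1}`. -/
def IsStep (g : ℝ → ℝ) : Prop :=
  ∃ (k : ℕ) (τ : Fin (k + 2) → ℝ) (c : Fin (k + 1) → ℝ),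
    StrictMono τ ∧ τ 0 = 0 ∧ τ (Fin.last (k + 1)) = 1 ∧
    (∀ i : Fin k, c i.castSucc ≠ c i.succ) ∧
    ∀ i : Fin (k + 1), ∀ x ∈ Ico (τ i.castSucc) (τ i.succ), g x = c i

/-- The set `J(g)` of change-points: the locations of discontinuity in `(0,1)`. For a step function
written as in `IsStep` this is `{τ_1, …, τ_k}`. -/
def changePoints (g : ℝ → ℝ) : Set ℝ := {x ∈ Ioo (0 : ℝ) 1 | ¬ ContinuousAt g x}

/-- The number `#J(g)` of change-points. -/
def numJumps (g : ℝ → ℝ) : ℕ∞ := (changePoints g).encard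

/-- The error `Δ_{q,k}(f)` of best `L^q` approximation by step functions with at most `k` jumps. -/
def approxError (q : ℝ≥0∞) (k : ℕ) (f : ℝ → ℝ) : ℝ≥0∞ :=
  ⨅ (g : ℝ → ℝ) (_ : IsStep g ∧ numJumps g ≤ k), lpNorm (fun x => f x - g x) q

/-- The approximation class `A^γ_{q,L}`: càdlàg functions with
`sup_{k ≥ 1} k^γ Δ_{q,k}(f) ≤ L` and `‖f‖_{L^∞} ≤ L`. -/
def approxClass (γ : ℝ) (q : ℝ≥0∞) (L : ℝ) : Set (ℝ → ℝ) :=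
  {f | IsCadlag f ∧
    (⨆ (k : ℕ) (_ : 1 ≤ k), (k : ℝ≥0∞) ^ γ * approxError q k f) ≤ ENNReal.ofReal L ∧
    lpNorm f ∞ ≤ ENNReal.ofReal L}

/-- The grid `{i/n : i = 0, …, n}`. -/
def grid (n : ℕ) : Set ℝ := {x | ∃ i : ℕ, i ≤ n ∧ x = (i : ℝ) / n}

/-- A `c`-normal system of intervals for sample size `n`. The interval `[u,v)` is encoded as the
pair `(u,v)`. -/
structure IsNormalSystem (c : ℝ) (n : ℕ) (S : Set (ℝ × ℝ)) : Prop where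
  isInterval : ∀ I ∈ S, 0 ≤ I.1 ∧ I.1 < I.2 ∧ I.2 ≤ 1
  rich : ∀ u v : ℝ, 0 ≤ u → v ≤ 1 → c / n < v - u →
    ∃ I ∈ S, Ico I.1 I.2 ⊆ Ico u v ∧ c⁻¹ * (v - u) ≤ I.2 - I.1
  onGrid : ∀ I ∈ S, I.1 ∈ grid n ∧ I.2 ∈ grid n
  cells : ∀ i : ℕ, i < n → ((i : ℝ) / n, ((i : ℝ) + 1) / n) ∈ S

/-- The local statistic `(n|I|)^{-1/2} |∑_{i/n ∈ I} (y_i - c)|` on the interval `I = [I.1, I.2)`. -/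
def localStat {n : ℕ} (y : Fin n → ℝ) (I : ℝ × ℝ) (c : ℝ) : ℝ :=
  open Classical in
  1 / √(n * (I.2 - I.1)) *
    |∑ i : Fin n, if ((i : ℕ) : ℝ) / n ∈ Ico I.1 I.2 then y i - c else 0|

/-- The multiscale statistic: the supremum, over the intervals `I` of the system on which the
candidate `g` is constant, of the local statistic minus the scale penalty `s I`. -/
def multiscaleStat {n : ℕ} (S : Set (ℝ × ℝ)) (s : ℝ × ℝ → ℝ) (y : Fin n → ℝ) (g : ℝ → ℝ) : EReal :=
  ⨆ (I : ℝ × ℝ) (_ : I ∈ S) (c : ℝ) (_ : ∀ x ∈ Ico I.1 I.2, g x = c),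
    ((localStat y I c - s I : ℝ) : EReal)

/-- The candidates for sample size `n`: step functions with change-points on the grid. -/
def IsCandidate (n : ℕ) (g : ℝ → ℝ) : Prop := IsStep g ∧ changePoints g ⊆ grid n

/-- `g` satisfies the multiscale side constraint with threshold `η`. The penalty `s` may depend on
the interval and on the candidate. -/
def IsFeasible {n : ℕ} (S : Set (ℝ × ℝ)) (s : ℝ × ℝ → (ℝ → ℝ) → ℝ) (η : ℝ) (y : Fin n → ℝ)
    (g : ℝ → ℝ) : Prop :=
  IsCandidate n g ∧ multiscaleStat S (fun I => s I g) y g ≤ (η : EReal)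

/-- `fhat` is a multiscale change-point segmentation of the data `y`: the penalties are bounded by
`δ √(log n)`, and `fhat` has the least number of jumps among the feasible candidates. -/
def IsSegmentation {n : ℕ} (S : Set (ℝ × ℝ)) (s : ℝ × ℝ → (ℝ → ℝ) → ℝ) (δ η : ℝ) (y : Fin n → ℝ)
    (fhat : ℝ → ℝ) : Prop :=
  (∀ I ∈ S, ∀ g : ℝ → ℝ, IsCandidate n g → |s I g| ≤ δ * √(Real.log n)) ∧
  IsFeasible S s η y fhat ∧
  ∀ g : ℝ → ℝ, IsFeasible S s η y g → numJumps fhat ≤ numJumps g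

/-- The observations `y_i = n ∫_{[i/n,(i+1)/n)} f + ξ_i`, `i = 0, …, n-1`. -/
def observations (n : ℕ) (f : ℝ → ℝ) (ξ : Fin n → ℝ) : Fin n → ℝ := fun i =>
  n * (∫ x in Ico (((i : ℕ) : ℝ) / n) ((((i : ℕ) : ℝ) + 1) / n), f x) + ξ i

/-- The normalising factor
`(log n)^{-(γ+(1/2-1/p)_+)/(2γ+1)} n^{(2γ/(2γ+1)) min{1/2,1/p}}`. -/
def invRate (γ p : ℝ) (n : ℕ) : ℝ :=
  Real.log n ^ (-((γ + max (1 / 2 - 1 / p) 0) / (2 * γ + 1))) *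
    (n : ℝ) ^ (2 * γ / (2 * γ + 1) * min (1 / 2) (1 / p))

end MultiscaleSeg

end

/-!
The estimator has at most as many jumps as any feasible candidate, and both it and such a candidate
have local means close to those of the data. This yields a bound for the squared error which is
proportional to the number of jumps, and hence to the complexity of the best feasible approximation
of the truth.

*Feasible candidate.* Put `κ = (n / log n)^{1/(2γ+1)}`. A truth `f` of the class has a step
approximant `g` with at most `⌈κ⌉` jumps and squared `L²` error `O(κ^{-2γ})`, since `q ≥ 2`.
Cutting the grid at the jumps of `g` and whenever the accumulated squared error has grown by
`θ ≍ (log n) / n` produces `O(κ)` plateaus, each contributing `O(θ)` to the squared error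
(`exists_cell_values`, `exists_candidate`). By Cauchy-Schwarz the bias of the local statistics is at
most `ε √(log n)`, so that the candidate satisfies the side constraint as soon as the normalized
partial sums of the noise are at most `t √(log n)` with `δ + t + ε ≤ a` (`isFeasible_cellFun`).
Minimality bounds the number of jumps of the estimator by `O(κ)`.

*Squared error.* On a common plateau `R` of the estimator and the candidate, an interval of the
normal system inside `R` of length at least `|R| / c` shows that the two values differ by
`O(√(log n / (n |R|)))` (`IsFeasible.plateau_dist`). Each of the `O(κ)` common plateaus therefore
contributes `O((log n) / n)` to the squared error, and the single cells, which belong to the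
normal system, bound the error by `O(√(log n))` everywhere (`exists_error_bound`). Interpolation
between these two bounds is exactly the rate in `L^p` (`invRate_mul_lpNorm_le`).

*Noise.* A union bound over all grid intervals would give an exceptional probability `O(n^{-r-ε})`,
which need not be summable. Grouping intervals by left end-point and geometric length scale, and
using an exponential maximal inequality (`measure_exists_blockSum_ge_le`), improves this to
`O(n^{-1-3r/4})` (`exists_tail_bound`). Borel-Cantelli then gives the almost sure statement. For the
risk, the error on the exceptional event grows at most linearly in the largest noise variable, whose
moments are controlled (`lintegral_rpow_le`).
-/

namespace MultiscaleSeg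

/-! ### Step functions -/

lemma exists_mem_Ico_of_partition {k : ℕ} {τ : Fin (k + 2) → ℝ} (h0 : τ 0 = 0)
    (h1 : τ (Fin.last (k + 1)) = 1) {x : ℝ} (hx : x ∈ Ico (0 : ℝ) 1) :
    ∃ i : Fin (k + 1), x ∈ Ico (τ i.castSucc) (τ i.succ) := by
  by_contra hcon
  simp only [mem_Ico, not_exists, not_and, not_lt] at hcon
  have : ∀ i : Fin (k + 2), τ i ≤ x := by
    intro i
    induction i using Fin.induction with
    | zero => rw [h0]; exact hx.1
    | succ i ih => exact hcon i ih
  have := this (Fin.last (k + 1))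
  rw [h1] at this
  exact absurd hx.2 (not_lt.2 this)

/-- A step function is described by a monotone label `N` (the index of the current plateau) which
increases only across a change-point, so that it takes at most `numJumps g + 1` values. -/
lemma IsStep.exists_label {g : ℝ → ℝ} (hg : IsStep g) :
    ∃ (k : ℕ) (N : ℝ → ℕ), (k : ℕ∞) ≤ numJumps g ∧ MonotoneOn N (Ico 0 1) ∧
      (∀ x ∈ Ico (0 : ℝ) 1, N x ≤ k) ∧
      (∀ x ∈ Ico (0 : ℝ) 1, ∀ y ∈ Ico (0 : ℝ) 1, N x = N y → g x = g y) ∧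
      (∀ x ∈ Ico (0 : ℝ) 1, ∀ y ∈ Ico (0 : ℝ) 1, N x < N y →
        ∃ z ∈ changePoints g, x < z ∧ z ≤ y) := by
  obtain ⟨k, τ, c, hτ, h0, h1, hc, hg⟩ := hg
  have hcov : ∀ x ∈ Ico (0 : ℝ) 1, ∃ i : Fin (k + 1), x ∈ Ico (τ i.castSucc) (τ i.succ) :=
    fun x hx => exists_mem_Ico_of_partition h0 h1 hx
  have hjump : ∀ i : Fin k, τ i.succ.castSucc ∈ changePoints g := by
    intro i
    refine ⟨⟨?_, ?_⟩, ?_⟩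
    · rw [← h0]; exact hτ (Fin.castSucc_pos (Fin.succ_pos i))
    · rw [← h1]; exact hτ (Fin.castSucc_lt_last _)
    · intro hcont
      have hval : g (τ i.succ.castSucc) = c i.succ :=
        hg i.succ _ ⟨le_rfl, hτ Fin.castSucc_lt_succ⟩
      have hlt : τ i.castSucc.castSucc < τ i.succ.castSucc :=
        hτ (by simp [Fin.lt_def])
      have hleft : ∀ᶠ y in 𝓝[<] (τ i.succ.castSucc), g y = c i.castSucc := by
        filter_upwards [Ioo_mem_nhdsLT hlt] with y hy
        refine hg i.castSucc y ⟨hy.1.le, ?_⟩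
        rw [Fin.succ_castSucc]; exact hy.2
      have ht : Tendsto g (𝓝[<] (τ i.succ.castSucc)) (𝓝 (c i.succ)) := by
        rw [← hval]; exact hcont.tendsto.mono_left nhdsWithin_le_nhds
      have ht' : Tendsto g (𝓝[<] (τ i.succ.castSucc)) (𝓝 (c i.castSucc)) :=
        tendsto_const_nhds.congr' (hleft.mono fun y hy => hy.symm)
      exact hc i (tendsto_nhds_unique ht' ht)
  classical
  choose! I hI using hcov
  have hmono : ∀ x ∈ Ico (0 : ℝ) 1, ∀ y ∈ Ico (0 : ℝ) 1, x ≤ y → I x ≤ I y := by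
    intro x hx y hy hxy
    have : τ (I x).castSucc < τ (I y).succ := ((hI x hx).1.trans hxy).trans_lt (hI y hy).2
    have := hτ.lt_iff_lt.1 this
    simp only [Fin.lt_def, Fin.val_castSucc, Fin.val_succ] at this
    rw [Fin.le_def]; omega
  refine ⟨k, fun x => I x, ?_, ?_, ?_, ?_, ?_⟩
  · have hinj : Function.Injective fun i : Fin k => τ i.succ.castSucc := fun i j hij => by
      simpa using hτ.injective hij
    have hsub : (Set.range fun i : Fin k => τ i.succ.castSucc) ⊆ changePoints g := by
      rintro _ ⟨i, rfl⟩; exact hjump i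
    calc (k : ℕ∞) = (Set.range fun i : Fin k => τ i.succ.castSucc).encard := by
          rw [← Set.image_univ, hinj.encard_image]; simp
      _ ≤ _ := Set.encard_le_encard hsub
  · intro x hx y hy hxy; exact hmono x hx y hy hxy
  · intro x _; have := (I x).isLt; show (I x : ℕ) ≤ k; omega
  · intro x hx y hy hxy
    rw [hg _ x (hI x hx), hg _ y (hI y hy), Fin.ext hxy]
  · intro x hx y hy hxy
    have hxk : (I x : ℕ) < k := lt_of_lt_of_le hxy (Nat.lt_succ_iff.1 (I y).isLt)
    refine ⟨_, hjump ⟨I x, hxk⟩, ?_, ?_⟩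
    · exact (hI x hx).2
    · refine le_trans (hτ.monotone ?_) (hI y hy).1
      rw [Fin.le_def]; simpa using hxy

lemma IsStep.continuousWithinAt {g : ℝ → ℝ} (hg : IsStep g) :
    ∀ x ∈ Ico (0 : ℝ) 1, ContinuousWithinAt g (Ici x) x := by
  obtain ⟨k, τ, c, hτ, h0, h1, hc, hg⟩ := hg
  intro x hx
  obtain ⟨i, hi⟩ := exists_mem_Ico_of_partition h0 h1 hx
  have : g =ᶠ[𝓝[≥] x] fun _ => g x := by
    filter_upwards [Ico_mem_nhdsGE hi.2] with y hy
    rw [hg i x hi, hg i y ⟨hi.1.trans hy.1, hy.2⟩]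
  exact continuousWithinAt_const.congr_of_eventuallyEq this rfl

/-- The function which is constant on the cells `[i/n, (i+1)/n)`, with value `w i` there. -/
noncomputable def cellFun (n : ℕ) (w : ℕ → ℝ) (x : ℝ) : ℝ := w ⌊(n : ℝ) * x⌋₊

lemma cellFun_eq {n : ℕ} (hn : 0 < n) (w : ℕ → ℝ) (i : ℕ) {x : ℝ}
    (hx : x ∈ Ico ((i : ℝ) / n) (((i : ℝ) + 1) / n)) : cellFun n w x = w i := by
  have hn' : (0 : ℝ) < n := by exact_mod_cast hn
  have h1 : (i : ℝ) ≤ n * x := by have := (div_le_iff₀ hn').1 hx.1; linarith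
  have h2 : n * x < (i : ℝ) + 1 := by have := (lt_div_iff₀ hn').1 hx.2; linarith
  rw [cellFun, (Nat.floor_eq_iff ((Nat.cast_nonneg i).trans h1)).2 ⟨h1, h2⟩]

lemma mem_cell_floor {n : ℕ} (hn : 0 < n) {x : ℝ} (hx : 0 ≤ x) :
    x ∈ Ico ((⌊(n : ℝ) * x⌋₊ : ℝ) / n) (((⌊(n : ℝ) * x⌋₊ : ℝ) + 1) / n) := by
  have hn' : (0 : ℝ) < n := by exact_mod_cast hn
  constructor
  · rw [div_le_iff₀ hn', mul_comm]; exact Nat.floor_le (by positivity)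
  · rw [lt_div_iff₀ hn', mul_comm]; exact Nat.lt_floor_add_one _

lemma floor_lt_of_mem {n : ℕ} (hn : 0 < n) {x : ℝ} (hx : x ∈ Ico (0 : ℝ) 1) :
    ⌊(n : ℝ) * x⌋₊ < n := by
  have hn' : (0 : ℝ) < n := by exact_mod_cast hn
  rw [Nat.floor_lt (mul_nonneg hn'.le hx.1)]
  nlinarith [hx.2]

lemma changePoints_cellFun_subset {n : ℕ} (hn : 0 < n) (w : ℕ → ℝ) :
    changePoints (cellFun n w) ⊆
      (fun i : ℕ => (i : ℝ) / n) '' {i | i ∈ Finset.Ico 1 n ∧ w i ≠ w (i - 1)} := by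
  have hn' : (0 : ℝ) < n := by exact_mod_cast hn
  rintro x ⟨hx, hcont⟩
  set i := ⌊(n : ℝ) * x⌋₊ with hi
  have hmem := mem_cell_floor hn hx.1.le
  rw [← hi] at hmem
  have hin : i < n := floor_lt_of_mem hn ⟨hx.1.le, hx.2⟩
  rcases hmem.1.eq_or_lt with heq | hlt
  · have hi1 : 1 ≤ i := by
      by_contra h
      have h0 : i = 0 := by omega
      rw [h0] at heq
      simp only [Nat.cast_zero, zero_div] at heq
      exact absurd hx.1 (by rw [heq]; exact lt_irrefl _)
    refine ⟨i, ⟨Finset.mem_Ico.2 ⟨hi1, hin⟩, fun hw => hcont ?_⟩, heq⟩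
    have hpred : (((i - 1 : ℕ) : ℝ)) = (i : ℝ) - 1 := by push_cast [hi1]; ring
    have : cellFun n w =ᶠ[𝓝 x] fun _ => w i := by
      have hlo : ((i : ℝ) - 1) / n < x := by
        rw [← heq]; gcongr; linarith
      filter_upwards [Ioo_mem_nhds hlo hmem.2] with y hy
      rcases lt_or_ge y x with hyx | hyx
      · rw [hw]
        refine cellFun_eq hn w (i - 1) ⟨?_, ?_⟩
        · rw [hpred]; exact hy.1.le
        · rw [hpred, sub_add_cancel, heq]; exact hyx
      · exact cellFun_eq hn w i ⟨hmem.1.trans hyx, hy.2⟩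
    exact continuousAt_const.congr this.symm
  · exfalso
    apply hcont
    have : cellFun n w =ᶠ[𝓝 x] fun _ => w i := by
      filter_upwards [Ioo_mem_nhds hlt hmem.2] with y hy
      exact cellFun_eq hn w i ⟨hy.1.le, hy.2⟩
    exact continuousAt_const.congr this.symm

lemma changePoints_cellFun_subset_grid {n : ℕ} (hn : 0 < n) (w : ℕ → ℝ) :
    changePoints (cellFun n w) ⊆ grid n := by
  intro x hx
  obtain ⟨i, ⟨hi, -⟩, rfl⟩ := changePoints_cellFun_subset hn w hx
  exact ⟨i, (Finset.mem_Ico.1 hi).2.le, rfl⟩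

open Classical in
lemma numJumps_cellFun_le {n : ℕ} (hn : 0 < n) (w : ℕ → ℝ) :
    numJumps (cellFun n w) ≤ ((Finset.Ico 1 n).filter fun i => w i ≠ w (i - 1)).card := by
  refine (Set.encard_le_encard (changePoints_cellFun_subset hn w)).trans ?_
  refine (Set.encard_image_le _ _).trans ?_
  rw [← Set.encard_coe_eq_coe_finsetCard]
  apply Set.encard_le_encard
  intro i hi
  simpa using hi

open Classical in
/-- For a function that is constant on cells, the change-points contain all grid points where two
neighbouring cell values differ. -/
lemma card_filter_le_numJumps {n : ℕ} (hn : 0 < n) {g : ℝ → ℝ} {w : ℕ → ℝ}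
    (hg : ∀ i < n, ∀ x ∈ Ico ((i : ℝ) / n) (((i : ℝ) + 1) / n), g x = w i) :
    (((Finset.Ico 1 n).filter fun i => w i ≠ w (i - 1)).card : ℕ∞) ≤ numJumps g := by
  have hn' : (0 : ℝ) < n := by exact_mod_cast hn
  have hinj : Function.Injective fun i : ℕ => (i : ℝ) / n := fun i j hij => by
    have : (i : ℝ) / n = j / n := hij
    field_simp at this
    exact_mod_cast this
  rw [← Set.encard_coe_eq_coe_finsetCard, ← hinj.encard_image]
  apply Set.encard_le_encard
  rintro _ ⟨i, hi, rfl⟩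
  simp only [Finset.coe_filter, Finset.mem_Ico, mem_ofPred_eq] at hi
  obtain ⟨⟨hi1, hin⟩, hne⟩ := hi
  have hpred : (((i - 1 : ℕ) : ℝ)) = (i : ℝ) - 1 := by push_cast [hi1]; ring
  have hi0 : (0 : ℝ) < i := by exact_mod_cast hi1
  refine ⟨⟨by positivity, ?_⟩, fun hcont => hne ?_⟩
  · rw [div_lt_one hn']; exact_mod_cast hin
  · have hlt : ((i : ℝ) - 1) / n < (i : ℝ) / n := by gcongr; linarith
    have hval : g ((i : ℝ) / n) = w i :=
      hg i hin _ ⟨le_rfl, by gcongr; linarith⟩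
    have hleft : ∀ᶠ y in 𝓝[<] ((i : ℝ) / n), g y = w (i - 1) := by
      filter_upwards [Ioo_mem_nhdsLT hlt] with y hy
      refine hg (i - 1) (by omega) y ⟨?_, ?_⟩
      · rw [hpred]; exact hy.1.le
      · rw [hpred, sub_add_cancel]; exact hy.2
    have ht : Tendsto g (𝓝[<] ((i : ℝ) / n)) (𝓝 (w i)) := by
      rw [← hval]; exact hcont.tendsto.mono_left nhdsWithin_le_nhds
    have ht' : Tendsto g (𝓝[<] ((i : ℝ) / n)) (𝓝 (w (i - 1))) :=
      tendsto_const_nhds.congr' (hleft.mono fun y hy => hy.symm)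
    exact tendsto_nhds_unique ht ht'

lemma isStep_cellFun {n : ℕ} (hn : 0 < n) (w : ℕ → ℝ) : IsStep (cellFun n w) := by
  classical
  have hn' : (0 : ℝ) < n := by exact_mod_cast hn
  -- the break points, in increasing order
  set T : Finset ℕ := (Finset.range (n + 1)).filter fun i => i = 0 ∨ i = n ∨ w i ≠ w (i - 1)
    with hT
  have h0T : 0 ∈ T := by simp [hT]
  have hnT : n ∈ T := by simp [hT]
  have hcard : 2 ≤ T.card := by
    rw [← Finset.card_pair hn.ne]
    exact Finset.card_le_card (by
      intro x hx
      rcases Finset.mem_insert.1 hx with rfl | hx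
      · exact h0T
      · rw [Finset.mem_singleton.1 hx]; exact hnT)
  obtain ⟨k, hk⟩ : ∃ k, T.card = k + 2 := ⟨T.card - 2, by omega⟩
  set e := T.orderEmbOfFin hk with he
  have he0 : e 0 = 0 := by
    have := Finset.orderEmbOfFin_zero hk (by omega)
    rw [he, show (0 : Fin (k + 2)) = ⟨0, by omega⟩ from rfl, this]
    exact Nat.le_zero.1 (Finset.min'_le _ _ h0T)
  have hel : e (Fin.last (k + 1)) = n := by
    have := Finset.orderEmbOfFin_last hk (by omega)
    rw [he, show (Fin.last (k + 1) : Fin (k + 2)) = ⟨k + 2 - 1, by omega⟩ from rfl, this]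
    refine le_antisymm (Finset.max'_le _ _ _ fun i hi => ?_) (Finset.le_max' _ _ hnT)
    have := (Finset.mem_filter.1 hi).1
    simpa [Nat.lt_succ_iff] using this
  have hgap : ∀ (i : Fin (k + 1)) (m : ℕ), e i.castSucc < m → m < e i.succ → m ∉ T := by
    intro i m h1 h2 hm
    have : m ∈ Set.range e := by
      rw [he, Finset.range_orderEmbOfFin]; exact hm
    obtain ⟨j, rfl⟩ := this
    have h1 := e.strictMono.lt_iff_lt.1 h1
    have h2 := e.strictMono.lt_iff_lt.1 h2
    simp only [Fin.lt_def, Fin.val_castSucc, Fin.val_succ] at h1 h2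
    omega
  have hle : ∀ i, e i ≤ n := fun i => by
    rw [← hel]; exact e.monotone (Fin.le_last i)
  have hconst : ∀ (i : Fin (k + 1)) (m : ℕ), e i.castSucc ≤ m → m < e i.succ →
      w m = w (e i.castSucc) := by
    intro i m hm
    induction m, hm using Nat.le_induction with
    | base => intro _; rfl
    | succ m hm ih =>
      intro h
      have hnot := hgap i (m + 1) (by omega) h
      have hmn : m + 1 < n := h.trans_le (hle _)
      simp only [hT, Finset.mem_filter, Finset.mem_range, not_and, not_or, not_not] at hnot
      have := (hnot (by omega)).2.2
      rw [this, Nat.add_sub_cancel]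
      exact ih (by omega)
  refine ⟨k, fun i => (e i : ℝ) / n, fun i => w (e i.castSucc), ?_, ?_, ?_, ?_, ?_⟩
  · intro i j hij
    have : e i < e j := e.strictMono hij
    show (e i : ℝ) / n < (e j : ℝ) / n
    gcongr
  · simp [he0]
  · simp only [hel]; field_simp
  · intro i
    have hm : e i.succ.castSucc ∈ T := Finset.orderEmbOfFin_mem _ _ _
    have hlt : e i.castSucc.castSucc < e i.castSucc.succ := e.strictMono Fin.castSucc_lt_succ
    have hlt2 : e i.succ.castSucc < n := by
      rw [← hel]; exact e.strictMono (Fin.castSucc_lt_last _)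
    rw [Fin.succ_castSucc] at hlt
    have h3 := hconst i.castSucc (e i.succ.castSucc - 1) (by omega)
      (by rw [Fin.succ_castSucc]; omega)
    show w (e i.castSucc.castSucc) ≠ w (e i.succ.castSucc)
    rw [← h3]
    have := (Finset.mem_filter.1 hm).2
    rcases this with h | h | h
    · omega
    · omega
    · exact fun h' => h h'.symm
  · intro i x hx
    have hx0 : 0 ≤ x := le_trans (by positivity) hx.1
    apply hconst i
    · rw [Nat.le_floor_iff (by positivity)]
      have := (div_le_iff₀ hn').1 hx.1
      linarith
    · rw [Nat.floor_lt (by positivity)]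
      have := (lt_div_iff₀ hn').1 hx.2
      linarith

/-- A step function with all change-points on the grid is constant on every cell. -/
lemma IsCandidate.eq_on_cell {n : ℕ} (hn : 0 < n) {g : ℝ → ℝ} (hg : IsCandidate n g) :
    ∀ i < n, ∀ x ∈ Ico ((i : ℝ) / n) (((i : ℝ) + 1) / n), g x = g ((i : ℝ) / n) := by
  have hn' : (0 : ℝ) < n := by exact_mod_cast hn
  obtain ⟨k, N, -, hmono, -, heq, hjump⟩ := hg.1.exists_label
  intro i hi x hx
  have hi1 : ((i : ℝ) + 1) / n ≤ 1 := by
    rw [div_le_one hn']; exact_mod_cast hi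
  have hi0 : (0 : ℝ) ≤ (i : ℝ) / n := by positivity
  have hxm : x ∈ Ico (0 : ℝ) 1 := ⟨hi0.trans hx.1, hx.2.trans_le hi1⟩
  have him : (i : ℝ) / n ∈ Ico (0 : ℝ) 1 := ⟨hi0, hx.1.trans_lt hxm.2⟩
  rcases (hmono him hxm hx.1).eq_or_lt with h | h
  · exact (heq _ him _ hxm h).symm
  · exfalso
    obtain ⟨z, hz, hz1, hz2⟩ := hjump _ him _ hxm h
    obtain ⟨j, -, rfl⟩ := hg.2 hz
    have h1 : (i : ℝ) < j := (div_lt_div_iff_of_pos_right hn').1 hz1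
    have h2 : (j : ℝ) < i + 1 := (div_lt_div_iff_of_pos_right hn').1 (hz2.trans_lt hx.2)
    have h1' : i < j := by exact_mod_cast h1
    have h2' : j < i + 1 := by exact_mod_cast h2
    omega

instance : IsProbabilityMeasure unitMeasure :=
  ⟨by simp [unitMeasure]⟩

/-- Right-continuous functions are measurable: they are limits of the functions
`x ↦ g ((⌊m x⌋ + 1) / m)`. -/
lemma aemeasurable_of_rightCont {g : ℝ → ℝ}
    (hg : ∀ x ∈ Ico (0 : ℝ) 1, ContinuousWithinAt g (Ici x) x) :
    AEMeasurable g unitMeasure := by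
  refine aemeasurable_of_tendsto_metrizable_ae (u := atTop)
    (f := fun (m : ℕ) x => g (((⌊((m : ℝ) + 1) * x⌋ : ℝ) + 1) / ((m : ℝ) + 1))) ?_ ?_
  · intro m
    have h1 : Measurable fun x : ℝ => ⌊((m : ℝ) + 1) * x⌋ :=
      Int.measurable_floor.comp (measurable_id.const_mul _)
    exact ((measurable_from_top (f := fun z : ℤ => g (((z : ℝ) + 1) / ((m : ℝ) + 1)))).comp
      h1).aemeasurable
  · unfold unitMeasure
    filter_upwards [ae_restrict_mem measurableSet_Ico] with x hx
    refine (hg x hx).tendsto.comp (tendsto_nhdsWithin_iff.2 ⟨?_, ?_⟩)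
    · have hinv : Tendsto (fun m : ℕ => x + 1 / ((m : ℝ) + 1)) atTop (𝓝 x) := by
        simpa using tendsto_const_nhds.add (tendsto_one_div_add_atTop_nhds_zero_nat (𝕜 := ℝ))
      refine tendsto_of_tendsto_of_tendsto_of_le_of_le tendsto_const_nhds hinv ?_ ?_
      · intro m
        have hm : (0 : ℝ) < m + 1 := by positivity
        have := (Int.lt_floor_add_one (((m : ℝ) + 1) * x)).le
        show x ≤ _
        rw [le_div_iff₀ hm]; linarith
      · intro m
        have hm : (0 : ℝ) < m + 1 := by positivity
        have := Int.floor_le (((m : ℝ) + 1) * x)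
        show _ ≤ x + 1 / ((m : ℝ) + 1)
        rw [div_le_iff₀ hm, add_mul x, one_div, inv_mul_cancel₀ hm.ne']; linarith
    · refine Eventually.of_forall fun m => ?_
      have hm : (0 : ℝ) < m + 1 := by positivity
      have := (Int.lt_floor_add_one (((m : ℝ) + 1) * x)).le
      show x ≤ _
      rw [le_div_iff₀ hm]; linarith

lemma ae_abs_le_of_mem_approxClass {γ L : ℝ} {q : ℝ≥0∞} {f : ℝ → ℝ} (hL : 0 ≤ L)
    (hf : f ∈ approxClass γ q L) : ∀ᵐ x ∂unitMeasure, |f x| ≤ L := by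
  have h := hf.2.2
  rw [lpNorm, eLpNorm_exponent_top] at h
  filter_upwards [enorm_ae_le_eLpNormEssSup f unitMeasure] with x hx
  have := hx.trans h
  rw [← ofReal_norm, ENNReal.ofReal_le_ofReal_iff hL] at this
  exact this

lemma aestronglyMeasurable_of_mem_approxClass {γ L : ℝ} {q : ℝ≥0∞} {f : ℝ → ℝ}
    (hf : f ∈ approxClass γ q L) : AEStronglyMeasurable f unitMeasure :=
  (aemeasurable_of_rightCont hf.1.1).aestronglyMeasurable

/-- Functions of the approximation class have, for every `k ≥ 1`, a step approximant with at most
`k` jumps and `L²` error at most `2 L k^{-γ}`. -/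
lemma exists_step_approx {γ L : ℝ} {q : ℝ≥0∞} (hL : 0 < L) (hq : 2 ≤ q)
    {f : ℝ → ℝ} (hf : f ∈ approxClass γ q L) {k : ℕ} (hk : 1 ≤ k) :
    ∃ g, IsStep g ∧ numJumps g ≤ k ∧
      lpNorm (fun x => f x - g x) 2 ≤ ENNReal.ofReal (2 * L * (k : ℝ) ^ (-γ)) := by
  have hk0 : (0 : ℝ) < k := by exact_mod_cast hk
  have h1 : (k : ℝ≥0∞) ^ γ * approxError q k f ≤ ENNReal.ofReal L :=
    (le_iSup₂ (f := fun (k : ℕ) (_ : 1 ≤ k) => (k : ℝ≥0∞) ^ γ * approxError q k f) k hk).trans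
      hf.2.1
  have hkγ : (k : ℝ≥0∞) ^ γ = ENNReal.ofReal ((k : ℝ) ^ γ) := by
    rw [← ENNReal.ofReal_natCast, ENNReal.ofReal_rpow_of_pos hk0]
  have hpos : 0 < (k : ℝ) ^ γ := Real.rpow_pos_of_pos hk0 _
  have h2 : approxError q k f ≤ ENNReal.ofReal (L * (k : ℝ) ^ (-γ)) := by
    rw [hkγ, mul_comm] at h1
    have := (ENNReal.le_div_iff_mul_le (Or.inl (by simpa using hpos))
      (Or.inl ENNReal.ofReal_ne_top)).2 h1
    rwa [← ENNReal.ofReal_div_of_pos hpos, div_eq_mul_inv, ← Real.rpow_neg hk0.le] at this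
  have h3 : approxError q k f < ENNReal.ofReal (2 * L * (k : ℝ) ^ (-γ)) := by
    refine h2.trans_lt ((ENNReal.ofReal_lt_ofReal_iff ?_).2 ?_)
    · have := Real.rpow_pos_of_pos hk0 (-γ); positivity
    · have := Real.rpow_pos_of_pos hk0 (-γ); nlinarith
  simp only [approxError, iInf_lt_iff] at h3
  obtain ⟨g, ⟨hg, hgk⟩, hlt⟩ := h3
  refine ⟨g, hg, hgk, le_trans ?_ hlt.le⟩
  refine eLpNorm_le_eLpNorm_of_exponent_le hq ?_
  exact (aestronglyMeasurable_of_mem_approxClass hf).sub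
    (aemeasurable_of_rightCont hg.continuousWithinAt).aestronglyMeasurable

/-! ### A piecewise constant candidate with few jumps -/

lemma integrableOn_sq_sub_const {f : ℝ → ℝ} {L : ℝ} (hfm : AEStronglyMeasurable f unitMeasure)
    (hfb : ∀ᵐ x ∂unitMeasure, |f x| ≤ L) (v : ℝ) {a b : ℝ} (ha : 0 ≤ a) (hb : b ≤ 1) :
    IntegrableOn (fun x => (f x - v) ^ 2) (Ico a b) := by
  have : Integrable (fun x => (f x - v) ^ 2) unitMeasure := by
    refine Integrable.of_bound (C := (L + |v|) ^ 2)
      ((hfm.sub aestronglyMeasurable_const).pow 2) ?_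
    filter_upwards [hfb] with x hx
    rw [Real.norm_eq_abs, abs_of_nonneg (sq_nonneg _), ← sq_abs]
    have := abs_sub (f x) v
    gcongr
    linarith
  exact IntegrableOn.mono_set this (Ico_subset_Ico ha hb)

lemma integrableOn_of_bound {f : ℝ → ℝ} {L : ℝ} (hfm : AEStronglyMeasurable f unitMeasure)
    (hfb : ∀ᵐ x ∂unitMeasure, |f x| ≤ L) {a b : ℝ} (ha : 0 ≤ a) (hb : b ≤ 1) :
    IntegrableOn f (Ico a b) := by
  have : Integrable f unitMeasure := Integrable.of_bound hfm L (by simpa using hfb)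
  exact IntegrableOn.mono_set this (Ico_subset_Ico ha hb)

lemma ae_restrict_Ico_of_unitMeasure {P : ℝ → Prop} (h : ∀ᵐ x ∂unitMeasure, P x) {a b : ℝ}
    (ha : 0 ≤ a) (hb : b ≤ 1) : ∀ᵐ x ∂(volume.restrict (Ico a b)), P x :=
  ae_restrict_of_ae_restrict_of_subset (Ico_subset_Ico ha hb) h

lemma setIntegral_Ico_add {F : ℝ → ℝ} {a b c : ℝ} (hab : a ≤ b) (hbc : b ≤ c)
    (hF : IntegrableOn F (Ico a c)) :
    ∫ x in Ico a c, F x = (∫ x in Ico a b, F x) + ∫ x in Ico b c, F x := by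
  rw [← Ico_union_Ico_eq_Ico hab hbc, setIntegral_union (by
    rw [Set.disjoint_left]; intro x h1 h2; exact absurd h1.2 (not_lt.2 h2.1)) measurableSet_Ico]
  · exact hF.mono_set (Ico_subset_Ico le_rfl hbc)
  · exact hF.mono_set (Ico_subset_Ico hab le_rfl)

open Classical in
lemma card_filter_ne_le {n : ℕ} (Λ : ℕ → ℕ) (hΛ : ∀ i, i + 1 < n → Λ i ≤ Λ (i + 1)) :
    ((Finset.Ico 1 n).filter fun i => Λ i ≠ Λ (i - 1)).card ≤ Λ (n - 1) := by
  induction n with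
  | zero => simp
  | succ n ih =>
    rcases Nat.eq_zero_or_pos n with rfl | hn
    · simp
    · have ih := ih fun i hi => hΛ i (by omega)
      rw [← Finset.insert_Ico_right_eq_Ico_add_one (by omega), Finset.filter_insert]
      have hstep := hΛ (n - 1) (by omega)
      rw [Nat.sub_add_cancel hn] at hstep
      simp only [Nat.add_sub_cancel]
      split_ifs with h
      · refine (Finset.card_insert_le _ _).trans ?_
        omega
      · omega

/-- Adding a small multiple of the labels to the values separates neighbours with different
labels. -/
lemma exists_perturbation {n : ℕ} (Λ : ℕ → ℕ) (v : ℕ → ℝ) {s₀ : ℝ} (hs₀ : 0 < s₀) :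
    ∃ s ∈ Ioo 0 s₀, ∀ i ∈ Finset.Ico 1 n, Λ i ≠ Λ (i - 1) →
      v i + s * Λ i ≠ v (i - 1) + s * Λ (i - 1) := by
  obtain ⟨s, hs, hs'⟩ := (Ioo_infinite hs₀).exists_notMem_finset
    ((Finset.Ico 1 n).image fun i => (v (i - 1) - v i) / ((Λ i : ℝ) - Λ (i - 1)))
  refine ⟨s, hs, fun i hi hne heq => hs' (Finset.mem_image.2 ⟨i, hi, ?_⟩)⟩
  have : ((Λ i : ℝ) - Λ (i - 1)) ≠ 0 := sub_ne_zero.2 (by exact_mod_cast hne)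
  rw [div_eq_iff this]; linarith

lemma abs_sub_clip_le {y v L : ℝ} (hy : |y| ≤ L) : |y - max (-L) (min L v)| ≤ |y - v| := by
  obtain ⟨h1, h2⟩ := abs_le.1 hy
  rcases le_total L v with h | h
  · rw [min_eq_left h, max_eq_right (by linarith), abs_sub_comm, abs_sub_comm y,
      abs_of_nonneg (by linarith), abs_of_nonneg (by linarith)]
    linarith
  · rw [min_eq_right h]
    rcases le_total (-L) v with h' | h'
    · rw [max_eq_right h']
    · rw [max_eq_left h', abs_of_nonneg (by linarith), abs_of_nonneg (by linarith)]
      linarith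

open Classical in
/-- Discretization of a step approximant `g` of `f` on the grid. The cells are labelled by the
plateau of `g` at their left end-point and by the integer part of `θ⁻¹ ∫ (f - g)²` up to that
point; on a run of cells with constant label, a single value is `L²`-close to `f`, up to the
contribution of the last cell, in which `g` may jump. The values are perturbed by at most `τ`
so that runs of constant value are runs of constant label. -/
lemma exists_cell_values {f g : ℝ → ℝ} {L E θ τ : ℝ} {n k : ℕ} (hn : 0 < n) (hL : 0 < L)
    (hθ : 0 < θ) (hτ : 0 < τ)
    (hfm : AEStronglyMeasurable f unitMeasure) (hfb : ∀ᵐ x ∂unitMeasure, |f x| ≤ L)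
    (hg : IsStep g) (hgk : numJumps g ≤ k)
    (hint : IntegrableOn (fun x => (f x - g x) ^ 2) (Ico 0 1))
    (hE : ∫ x in Ico (0 : ℝ) 1, (f x - g x) ^ 2 ≤ E) :
    ∃ w : ℕ → ℝ,
      (((Finset.Ico 1 n).filter fun i => w i ≠ w (i - 1)).card : ℝ) ≤ E / θ + k ∧
      ∀ i₀ i₁, i₀ ≤ i₁ → i₁ < n → (∀ i ∈ Finset.Ioc i₀ i₁, w i = w (i - 1)) →
        ∫ x in Ico ((i₀ : ℝ) / n) (((i₁ : ℝ) + 1) / n), (f x - w i₀) ^ 2 ≤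
          2 * (θ + 4 * L ^ 2 / n + τ ^ 2) := by
  have hn' : (0 : ℝ) < n := by exact_mod_cast hn
  obtain ⟨k', N, hk', hNmono, hNk, hNeq, -⟩ := hg.exists_label
  have hkk : k' ≤ k := by exact_mod_cast hk'.trans hgk
  set G : ℝ → ℝ := fun x => ∫ y in Ico (0 : ℝ) x, (f y - g y) ^ 2 with hG
  have hGmono : ∀ a b, a ≤ b → b ≤ 1 → G a ≤ G b := fun a b hab hb =>
    setIntegral_mono_set (hint.mono_set (Ico_subset_Ico le_rfl hb))
      (Eventually.of_forall fun x => sq_nonneg _) (Ico_subset_Ico le_rfl hab).eventuallyLE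
  have hG0 : ∀ a, 0 ≤ G a := fun a => integral_nonneg fun x => sq_nonneg _
  have hmem : ∀ i < n, (i : ℝ) / n ∈ Ico (0 : ℝ) 1 := fun i hi =>
    ⟨by positivity, by rw [div_lt_one hn']; exact_mod_cast hi⟩
  set Λ : ℕ → ℕ := fun i => ⌊G (i / n) / θ⌋₊ + N (i / n) with hΛ
  have hfl : ∀ i j, i ≤ j → j < n → ⌊G (i / n) / θ⌋₊ ≤ ⌊G (j / n) / θ⌋₊ := fun i j hij hj => by
    refine Nat.floor_le_floor (div_le_div_of_nonneg_right (hGmono _ _ ?_ (hmem j hj).2.le) hθ.le)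
    gcongr
  have hNl : ∀ i j, i ≤ j → j < n → N (i / n) ≤ N (j / n) := fun i j hij hj =>
    hNmono (hmem i (by omega)) (hmem j hj) (by gcongr)
  have hΛmono : ∀ i j, i ≤ j → j < n → Λ i ≤ Λ j := fun i j hij hj =>
    add_le_add (hfl i j hij hj) (hNl i j hij hj)
  set v : ℕ → ℝ := fun i => max (-L) (min L (g (i / n))) with hv
  obtain ⟨s, hs, hsne⟩ := exists_perturbation (n := n) Λ v
    (s₀ := τ / (Λ (n - 1) + 1)) (by positivity)
  refine ⟨fun i => v i + s * Λ i, ?_, ?_⟩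
  · have h1 : ((Finset.Ico 1 n).filter fun i => v i + s * Λ i ≠ v (i - 1) + s * Λ (i - 1)).card
        ≤ Λ (n - 1) := by
      refine le_trans (Finset.card_le_card ?_)
        (card_filter_ne_le Λ fun i hi => hΛmono _ _ (by omega) hi)
      -- equal labels at neighbouring cells force equal values
      intro i hi
      rw [Finset.mem_filter] at hi ⊢
      refine ⟨hi.1, fun heq => hi.2 ?_⟩
      obtain ⟨hi1, hin⟩ := Finset.mem_Ico.1 hi.1
      have e1 := hfl (i - 1) i (by omega) hin
      have e2 := hNl (i - 1) i (by omega) hin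
      have e3 : N (((i - 1 : ℕ) : ℝ) / n) = N ((i : ℝ) / n) := by
        simp only [hΛ] at heq; omega
      have e4 := hNeq _ (hmem (i - 1) (by omega)) _ (hmem i hin) e3
      simp only [hv, heq, e4]
    have h2 : (Λ (n - 1) : ℝ) ≤ E / θ + k := by
      have hlast := hmem (n - 1) (by omega)
      simp only [hΛ]
      push_cast
      have a1 : (⌊G (((n - 1 : ℕ) : ℝ) / n) / θ⌋₊ : ℝ) ≤ E / θ := by
        refine (Nat.floor_le (div_nonneg (hG0 _) hθ.le)).trans ?_
        exact div_le_div_of_nonneg_right ((hGmono _ _ hlast.2.le le_rfl).trans hE) hθ.le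
      have a2 : (N (((n - 1 : ℕ) : ℝ) / n) : ℝ) ≤ k := by
        exact_mod_cast (hNk _ hlast).trans hkk
      linarith
    exact le_trans (by exact_mod_cast h1) h2
  · intro i₀ i₁ h01 h1n hconst
    have hΛc : ∀ i, i₀ ≤ i → i ≤ i₁ → Λ i = Λ i₀ := by
      intro i hi
      induction i, hi using Nat.le_induction with
      | base => intro _; rfl
      | succ i hi ih =>
        intro h
        rw [← ih (by omega)]
        by_contra hne
        exact hsne (i + 1) (Finset.mem_Ico.2 ⟨by omega, by omega⟩) (by simpa using hne)
          (hconst (i + 1) (Finset.mem_Ioc.2 ⟨by omega, h⟩))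
    have hfl1 : ⌊G (i₁ / n) / θ⌋₊ = ⌊G (i₀ / n) / θ⌋₊ := by
      have := hΛc i₁ h01 le_rfl
      have e1 := hfl i₀ i₁ h01 h1n
      have e2 := hNl i₀ i₁ h01 h1n
      simp only [hΛ] at this; omega
    have hN1 : N (i₁ / n) = N (i₀ / n) := by
      have := hΛc i₁ h01 le_rfl
      have e1 := hfl i₀ i₁ h01 h1n
      have e2 := hNl i₀ i₁ h01 h1n
      simp only [hΛ] at this; omega
    have hm0 := hmem i₀ (by omega)
    have hm1 := hmem i₁ h1n
    have h01' : (i₀ : ℝ) / n ≤ i₁ / n := by gcongr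
    have hend : ((i₁ : ℝ) + 1) / n ≤ 1 := by rw [div_le_one hn']; exact_mod_cast h1n
    have h1e : (i₁ : ℝ) / n ≤ ((i₁ : ℝ) + 1) / n := by gcongr; linarith
    -- the part of the run where `g` is constant
    have hA : ∫ x in Ico ((i₀ : ℝ) / n) ((i₁ : ℝ) / n), (f x - v i₀) ^ 2 ≤ θ := by
      have hsub : G (i₁ / n) = G (i₀ / n) +
          ∫ x in Ico ((i₀ : ℝ) / n) ((i₁ : ℝ) / n), (f x - g x) ^ 2 :=
        setIntegral_Ico_add hm0.1 h01' (hint.mono_set (Ico_subset_Ico le_rfl hm1.2.le))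
      have hlt : G (i₁ / n) - G (i₀ / n) ≤ θ := by
        have u1 := Nat.lt_floor_add_one (G (i₁ / n) / θ)
        have u2 := Nat.floor_le (div_nonneg (hG0 (i₀ / n)) hθ.le)
        rw [hfl1] at u1
        have : G (i₁ / n) / θ - G (i₀ / n) / θ ≤ 1 := by linarith
        rwa [← sub_div, div_le_one hθ] at this
      refine le_trans (setIntegral_mono_ae_restrict
        (integrableOn_sq_sub_const hfm hfb _ hm0.1 hm1.2.le)
        (hint.mono_set (Ico_subset_Ico hm0.1 hm1.2.le)) ?_) (by linarith)
      filter_upwards [ae_restrict_Ico_of_unitMeasure hfb hm0.1 hm1.2.le,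
        ae_restrict_mem measurableSet_Ico] with x hx hxm
      have hx01 : x ∈ Ico (0 : ℝ) 1 := ⟨hm0.1.trans hxm.1, hxm.2.trans hm1.2⟩
      have hNx : N ((i₀ : ℝ) / n) = N x := le_antisymm (hNmono hm0 hx01 hxm.1)
        (by rw [← hN1]; exact hNmono hx01 hm1 hxm.2.le)
      rw [← hNeq _ hm0 _ hx01 hNx]
      exact sq_le_sq.2 (abs_sub_clip_le hx)
    -- the last cell
    have hB : ∫ x in Ico ((i₁ : ℝ) / n) (((i₁ : ℝ) + 1) / n), (f x - v i₀) ^ 2 ≤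
        4 * L ^ 2 / n := by
      have hle : ∀ᵐ x ∂(volume.restrict (Ico ((i₁ : ℝ) / n) (((i₁ : ℝ) + 1) / n))),
          (f x - v i₀) ^ 2 ≤ 4 * L ^ 2 := by
        filter_upwards [ae_restrict_Ico_of_unitMeasure hfb hm1.1 hend] with x hx
        have h3 : |v i₀| ≤ L := abs_le.2 ⟨le_max_left _ _, max_le (by linarith) (min_le_left _ _)⟩
        have h4 : |f x - v i₀| ≤ 2 * L := (abs_sub _ _).trans (by linarith)
        calc (f x - v i₀) ^ 2 = |f x - v i₀| ^ 2 := (sq_abs _).symm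
          _ ≤ (2 * L) ^ 2 := by gcongr
          _ = 4 * L ^ 2 := by ring
      refine (setIntegral_mono_ae_restrict (integrableOn_sq_sub_const hfm hfb _ hm1.1 hend)
        (integrableOn_const (by simp)) hle).trans (le_of_eq ?_)
      rw [setIntegral_const, smul_eq_mul, measureReal_def, Real.volume_Ico,
        ENNReal.toReal_ofReal (by linarith), ← sub_div]
      ring
    have hΛle : s * Λ i₀ ≤ τ := by
      have h1 : (Λ i₀ : ℝ) ≤ Λ (n - 1) := by exact_mod_cast hΛmono i₀ (n - 1) (by omega) (by omega)
      have h2 := hs.2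
      rw [lt_div_iff₀ (by positivity)] at h2
      nlinarith [hs.1]
    have hΛ0 : 0 ≤ s * Λ i₀ := mul_nonneg hs.1.le (Nat.cast_nonneg _)
    have hI := integrableOn_sq_sub_const hfm hfb (v i₀) hm0.1 hend
    calc ∫ x in Ico ((i₀ : ℝ) / n) (((i₁ : ℝ) + 1) / n), (f x - (v i₀ + s * Λ i₀)) ^ 2
        ≤ ∫ x in Ico ((i₀ : ℝ) / n) (((i₁ : ℝ) + 1) / n), (2 * (f x - v i₀) ^ 2 + 2 * τ ^ 2) := by
          refine setIntegral_mono (integrableOn_sq_sub_const hfm hfb _ hm0.1 hend)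
            ((hI.const_mul 2).add (integrableOn_const (by simp))) fun x => ?_
          have : (s * Λ i₀) ^ 2 ≤ τ ^ 2 := by gcongr
          show (f x - (v i₀ + s * Λ i₀)) ^ 2 ≤ 2 * (f x - v i₀) ^ 2 + 2 * τ ^ 2
          nlinarith [sq_nonneg (f x - v i₀ + s * Λ i₀)]
      _ = 2 * (∫ x in Ico ((i₀ : ℝ) / n) (((i₁ : ℝ) + 1) / n), (f x - v i₀) ^ 2) +
          2 * τ ^ 2 * (((i₁ : ℝ) + 1) / n - i₀ / n) := by
          rw [integral_add (hI.const_mul 2) (integrableOn_const (by simp)), integral_const_mul,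
            setIntegral_const, smul_eq_mul, measureReal_def, Real.volume_Ico,
            ENNReal.toReal_ofReal (by linarith)]
          ring
      _ ≤ 2 * (θ + 4 * L ^ 2 / n) + 2 * τ ^ 2 * 1 := by
          rw [setIntegral_Ico_add h01' h1e hI]
          have : ((i₁ : ℝ) + 1) / n - i₀ / n ≤ 1 := by linarith [hm0.1]
          gcongr
      _ = _ := by ring

/-- The integrated squared error of a step approximant is finite and controlled by its `L²`
norm. -/
lemma integral_sq_le_of_lpNorm_le {F : ℝ → ℝ} {A : ℝ} (hA : 0 ≤ A)
    (hF : AEStronglyMeasurable F unitMeasure) (h : lpNorm F 2 ≤ ENNReal.ofReal A) :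
    IntegrableOn (fun x => F x ^ 2) (Ico 0 1) ∧ ∫ x in Ico (0 : ℝ) 1, F x ^ 2 ≤ A ^ 2 := by
  have hmem : MemLp F 2 unitMeasure := ⟨hF, h.trans_lt ENNReal.ofReal_lt_top⟩
  refine ⟨hmem.integrable_sq, ?_⟩
  rw [lpNorm, hmem.eLpNorm_eq_integral_rpow_norm (by norm_num) (by norm_num),
    ENNReal.ofReal_le_ofReal_iff hA] at h
  simp only [ENNReal.toReal_ofNat, Real.rpow_ofNat, Real.norm_eq_abs, sq_abs] at h
  have h0 : 0 ≤ ∫ x, F x ^ 2 ∂unitMeasure := integral_nonneg fun x => sq_nonneg _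
  rw [← one_div, ← Real.sqrt_eq_rpow, Real.sqrt_le_iff] at h
  exact h.2

/-- On runs of cells with constant value, the squared `L²` distance between `f` and the piecewise
constant function with cell values `w` is at most `b² / n`. -/
def RunBound (n : ℕ) (f : ℝ → ℝ) (w : ℕ → ℝ) (b : ℝ) : Prop :=
  ∀ i₀ i₁ : ℕ, i₀ ≤ i₁ → i₁ < n → (∀ i ∈ Finset.Ioc i₀ i₁, w i = w (i - 1)) →
    ∫ x in Ico ((i₀ : ℝ) / n) (((i₁ : ℝ) + 1) / n), (f x - w i₀) ^ 2 ≤ b ^ 2 / n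

/-- The order of magnitude `(n / log n)^{1/(2γ+1)}` of the number of jumps, at which the
approximation error `k^{-2γ}` balances the stochastic error `k (log n) / n`. It is meaningful for
`log n ≥ 1`, the only case in which it is used. -/
noncomputable def jumpScale (γ : ℝ) (n : ℕ) : ℝ := (n / Real.log n) ^ (1 / (2 * γ + 1))

lemma eventually_le_log (K : ℝ) : ∀ᶠ n : ℕ in atTop, K ≤ Real.log n :=
  (Real.tendsto_log_atTop.comp tendsto_natCast_atTop_atTop).eventually_ge_atTop K

lemma one_le_jumpScale {γ : ℝ} (hγ : 0 < γ) {n : ℕ} (hn : 1 ≤ Real.log n) :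
    1 ≤ jumpScale γ n := by
  refine Real.one_le_rpow ?_ (by positivity)
  rw [one_le_div (by linarith)]
  exact Real.log_le_self (Nat.cast_nonneg n)

lemma pos_of_one_le_log {n : ℕ} (hn : 1 ≤ Real.log n) : 0 < n := by
  rcases Nat.eq_zero_or_pos n with rfl | h
  · norm_num at hn
  · exact h

open Classical in
/-- Uniformly over the approximation class there are piecewise constant functions on the grid
with `O((n / log n)^{1/(2γ+1)})` jumps, each of whose plateaus contributes at most
`ε² (log n) / n` to the squared error. -/
lemma exists_candidate {γ L ε : ℝ} {q : ℝ≥0∞} (hγ : 0 < γ) (hL : 0 < L) (hε : 0 < ε)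
    (hq : 2 ≤ q) :
    ∃ C : ℝ, 0 < C ∧ ∀ᶠ n : ℕ in atTop, ∀ f ∈ approxClass γ q L, ∃ w : ℕ → ℝ,
      (((Finset.Ico 1 n).filter fun i => w i ≠ w (i - 1)).card : ℝ) ≤ C * jumpScale γ n ∧
      RunBound n f w (ε * √(Real.log n)) := by
  refine ⟨32 * L ^ 2 / ε ^ 2 + 2, by positivity, ?_⟩
  filter_upwards [eventually_le_log 1, eventually_le_log (40 * L ^ 2 / ε ^ 2)] with n h1 h2 f hf
  have hn := pos_of_one_le_log h1
  have hn' : (0 : ℝ) < n := by exact_mod_cast hn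
  set l := Real.log n with hl
  have hl0 : 0 < l := by linarith
  have hκ1 := one_le_jumpScale hγ h1
  set κ := jumpScale γ n with hκ
  have hκ0 : 0 < κ := by linarith
  set k := ⌈κ⌉₊ with hk
  have hk1 : 1 ≤ k := Nat.one_le_ceil_iff.2 hκ0
  have hkκ : κ ≤ k := Nat.le_ceil _
  have hk2 : (k : ℝ) ≤ 2 * κ := by
    have := Nat.ceil_lt_add_one hκ0.le; linarith
  have hk0 : (0 : ℝ) < k := by linarith
  obtain ⟨g, hg, hgk, hgL⟩ := exists_step_approx hL hq hf hk1
  have hfm := aestronglyMeasurable_of_mem_approxClass hf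
  have hfb := ae_abs_le_of_mem_approxClass hL.le hf
  have hkp := Real.rpow_pos_of_pos hk0 (-γ)
  obtain ⟨hint, hE⟩ := integral_sq_le_of_lpNorm_le (by positivity)
    (hfm.sub (aemeasurable_of_rightCont hg.continuousWithinAt).aestronglyMeasurable) hgL
  -- `θ` takes up a quarter of the admissible error per plateau; the last cells and the
  -- perturbation, both of order `1 / n`, fit into the rest once `log n` is large
  set θ := ε ^ 2 * l / (8 * n) with hθ
  have hθ0 : 0 < θ := by positivity
  obtain ⟨w, hw1, hw2⟩ := exists_cell_values (τ := L / √n) hn hL hθ0 (by positivity) hfm hfb hg hgk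
    hint hE
  refine ⟨w, hw1.trans ?_, fun i₀ i₁ h01 hi hc => (hw2 i₀ i₁ h01 hi hc).trans ?_⟩
  · have hsq : (2 * L * (k : ℝ) ^ (-γ)) ^ 2 ≤ 4 * L ^ 2 * κ ^ (-(2 * γ)) := by
      have e1 : ((k : ℝ) ^ (-γ)) ^ 2 = (k : ℝ) ^ (-(2 * γ)) := by
        rw [← Real.rpow_natCast, ← Real.rpow_mul hk0.le]; congr 1; push_cast; ring
      have e2 : (k : ℝ) ^ (-(2 * γ)) ≤ κ ^ (-(2 * γ)) :=
        Real.rpow_le_rpow_of_nonpos hκ0 hkκ (by linarith)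
      calc (2 * L * (k : ℝ) ^ (-γ)) ^ 2 = 4 * L ^ 2 * ((k : ℝ) ^ (-γ)) ^ 2 := by ring
        _ ≤ _ := by rw [e1]; gcongr
    have hid : (n : ℝ) / l = κ ^ (2 * γ + 1) := by
      rw [hκ, jumpScale, ← Real.rpow_mul (by positivity), one_div_mul_cancel (by positivity),
        Real.rpow_one]
    have hid2 : κ ^ (-(2 * γ)) * ((n : ℝ) / l) = κ := by
      rw [hid, ← Real.rpow_add hκ0]
      have : -(2 * γ) + (2 * γ + 1) = 1 := by ring
      rw [this, Real.rpow_one]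
    calc (2 * L * (k : ℝ) ^ (-γ)) ^ 2 / θ + k
        ≤ 4 * L ^ 2 * κ ^ (-(2 * γ)) / θ + 2 * κ := by gcongr
      _ = 32 * L ^ 2 / ε ^ 2 * (κ ^ (-(2 * γ)) * ((n : ℝ) / l)) + 2 * κ := by
          rw [hθ]; field_simp; ring
      _ = (32 * L ^ 2 / ε ^ 2 + 2) * κ := by rw [hid2]; ring
  · rw [div_pow, Real.sq_sqrt hn'.le, mul_pow, Real.sq_sqrt hl0.le]
    have h3 : 40 * L ^ 2 ≤ ε ^ 2 * l := by
      rw [div_le_iff₀ (by positivity)] at h2; linarith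
    rw [le_div_iff₀ hn', hθ]
    have : 2 * (ε ^ 2 * l / (8 * n) + 4 * L ^ 2 / n + L ^ 2 / n) * n
        = ε ^ 2 * l / 4 + 10 * L ^ 2 := by field_simp; ring
    have hpos : 0 ≤ ε ^ 2 * l := by positivity
    rw [this]; linarith

/-! ### Local statistics on grid intervals -/

/-- The sum of `y i` over the indices `u ≤ i < v`. -/
def blockSum {n : ℕ} (y : Fin n → ℝ) (u v : ℕ) : ℝ :=
  ∑ i ∈ Finset.univ.filter (fun i : Fin n => u ≤ (i : ℕ) ∧ (i : ℕ) < v), y i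

lemma blockSum_self {n : ℕ} (y : Fin n → ℝ) (u : ℕ) : blockSum y u u = 0 := by
  rw [blockSum, Finset.filter_false_of_mem (fun i _ => by omega), Finset.sum_empty]

lemma blockSum_succ {n : ℕ} (y : Fin n → ℝ) {u v : ℕ} (huv : u ≤ v) (hv : v < n) :
    blockSum y u (v + 1) = blockSum y u v + y ⟨v, hv⟩ := by
  have : (Finset.univ.filter fun i : Fin n => u ≤ (i : ℕ) ∧ (i : ℕ) < v + 1) =
      insert ⟨v, hv⟩ (Finset.univ.filter fun i : Fin n => u ≤ (i : ℕ) ∧ (i : ℕ) < v) := by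
    ext i
    simp only [Finset.mem_filter, Finset.mem_univ, true_and, Finset.mem_insert, Fin.ext_iff]
    omega
  rw [blockSum, this, Finset.sum_insert (by simp), add_comm, blockSum]

lemma blockSum_observations {n : ℕ} {f : ℝ → ℝ} (hf : IntegrableOn f (Ico 0 1))
    (ξ : Fin n → ℝ) {u v : ℕ} (huv : u ≤ v) (hv : v ≤ n) :
    blockSum (observations n f ξ) u v =
      blockSum ξ u v + n * ∫ x in Ico ((u : ℝ) / n) ((v : ℝ) / n), f x := by
  induction v, huv using Nat.le_induction with
  | base => simp [blockSum_self]
  | succ v huv ih =>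
    have hn' : (0 : ℝ) < n := by exact_mod_cast (by omega : 0 < n)
    rw [blockSum_succ _ huv hv, blockSum_succ _ huv hv, ih (by omega), observations]
    rw [setIntegral_Ico_add (a := (u : ℝ) / n) (b := (v : ℝ) / n) (c := ((v + 1 : ℕ) : ℝ) / n)
      (by gcongr) (by gcongr; simp)
      (hf.mono_set (Ico_subset_Ico (by positivity)
        (by rw [div_le_one hn']; exact_mod_cast hv)))]
    push_cast
    ring

lemma localStat_eq {n : ℕ} (hn : 0 < n) (y : Fin n → ℝ) {u v : ℕ} (huv : u ≤ v) (hv : v ≤ n)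
    (c : ℝ) : localStat y ((u : ℝ) / n, (v : ℝ) / n) c =
      1 / √((v : ℝ) - u) * |blockSum y u v - ((v : ℝ) - u) * c| := by
  have hn' : (0 : ℝ) < n := by exact_mod_cast hn
  have hmem : ∀ i : ℕ, ((i : ℝ) / n ∈ Ico ((u : ℝ) / n) ((v : ℝ) / n)) ↔ (u ≤ i ∧ i < v) := by
    intro i
    rw [mem_Ico, div_le_div_iff_of_pos_right hn', div_lt_div_iff_of_pos_right hn']
    simp
  have hcard : ∀ v, u ≤ v → v ≤ n → blockSum (n := n) (fun _ => c) u v = ((v : ℝ) - u) * c := by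
    intro v huv
    induction v, huv using Nat.le_induction with
    | base => intro _; simp [blockSum_self]
    | succ v huv ih =>
      intro h
      rw [blockSum_succ _ huv h, ih (by omega)]; push_cast; ring
  rw [localStat]
  congr 2
  · congr 1; field_simp
  · rw [← hcard v huv hv, blockSum, blockSum, ← Finset.sum_sub_distrib, Finset.sum_filter]
    refine Finset.sum_congr rfl fun i _ => ?_
    simp only [hmem]

lemma sq_setIntegral_le {F : ℝ → ℝ} {a b : ℝ} (hab : a < b) (hF : IntegrableOn F (Ico a b))
    (hF2 : IntegrableOn (fun x => F x ^ 2) (Ico a b)) :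
    (∫ x in Ico a b, F x) ^ 2 ≤ (b - a) * ∫ x in Ico a b, F x ^ 2 := by
  set m := (∫ x in Ico a b, F x) / (b - a) with hm
  have hba : 0 < b - a := by linarith
  have h0 : 0 ≤ ∫ x in Ico a b, (F x ^ 2 - 2 * m * F x + m ^ 2) :=
    integral_nonneg fun x => by
      show 0 ≤ F x ^ 2 - 2 * m * F x + m ^ 2
      nlinarith [sq_nonneg (F x - m)]
  have hFm : IntegrableOn (fun x => 2 * m * F x) (Ico a b) := hF.const_mul _
  have hd : IntegrableOn (fun x => F x ^ 2 - 2 * m * F x) (Ico a b) := hF2.sub hFm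
  rw [integral_add hd (integrableOn_const (by simp)), integral_sub hF2 hFm,
    integral_const_mul, setIntegral_const, smul_eq_mul,
    measureReal_def, Real.volume_Ico, ENNReal.toReal_ofReal hba.le] at h0
  have hI : ∫ x in Ico a b, F x = m * (b - a) := by rw [hm]; field_simp
  rw [hI] at h0 ⊢
  nlinarith

/-- Cauchy-Schwarz on a plateau: the average of `f` is close to the value of the candidate. -/
lemma RunBound.abs_integral_le {n : ℕ} {f : ℝ → ℝ} {w : ℕ → ℝ} {b L : ℝ} (hb : 0 ≤ b)
    (hw : RunBound n f w b) (hfm : AEStronglyMeasurable f unitMeasure)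
    (hfb : ∀ᵐ x ∂unitMeasure, |f x| ≤ L) {u v : ℕ} (huv : u < v) (hv : v ≤ n)
    (hc : ∀ i ∈ Finset.Ico u v, w i = w u) :
    |n * (∫ x in Ico ((u : ℝ) / n) ((v : ℝ) / n), f x) - ((v : ℝ) - u) * w u| ≤
      b * √((v : ℝ) - u) := by
  have hn' : (0 : ℝ) < n := by exact_mod_cast (by omega : 0 < n)
  have hlt : (u : ℝ) / n < (v : ℝ) / n := by gcongr
  have hv1 : (v : ℝ) / n ≤ 1 := by rw [div_le_one hn']; exact_mod_cast hv
  have hu0 : (0 : ℝ) ≤ (u : ℝ) / n := by positivity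
  have hvu : (0 : ℝ) < (v : ℝ) - u := by rw [sub_pos]; exact_mod_cast huv
  have h1 := hw u (v - 1) (by omega) (by omega) (by
    intro i hi
    obtain ⟨h1, h2⟩ := Finset.mem_Ioc.1 hi
    rw [hc i (Finset.mem_Ico.2 ⟨by omega, by omega⟩),
      hc (i - 1) (Finset.mem_Ico.2 ⟨by omega, by omega⟩)])
  have hvc : (((v - 1 : ℕ) : ℝ) + 1) = v := by
    have : v - 1 + 1 = v := by omega
    exact_mod_cast this
  rw [hvc] at h1
  have hfi := integrableOn_of_bound hfm hfb hu0 hv1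
  have h2 := sq_setIntegral_le hlt (hfi.sub (integrableOn_const (by simp) (C := w u)))
    (integrableOn_sq_sub_const hfm hfb (w u) hu0 hv1)
  have h3 : ∫ x in Ico ((u : ℝ) / n) ((v : ℝ) / n), (f x - w u) =
      (∫ x in Ico ((u : ℝ) / n) ((v : ℝ) / n), f x) - ((v : ℝ) / n - u / n) * w u := by
    rw [integral_sub hfi (integrableOn_const (by simp)), setIntegral_const, smul_eq_mul,
      measureReal_def, Real.volume_Ico, ENNReal.toReal_ofReal (by linarith)]
  have h4 : n * (∫ x in Ico ((u : ℝ) / n) ((v : ℝ) / n), f x) - ((v : ℝ) - u) * w u =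
      n * ∫ x in Ico ((u : ℝ) / n) ((v : ℝ) / n), (f x - w u) := by
    rw [h3]; field_simp
  rw [h4]
  apply abs_le_of_sq_le_sq _ (by positivity)
  rw [mul_pow, mul_pow, Real.sq_sqrt hvu.le]
  calc (n : ℝ) ^ 2 * (∫ x in Ico ((u : ℝ) / n) ((v : ℝ) / n), (f x - w u)) ^ 2
      ≤ (n : ℝ) ^ 2 * (((v : ℝ) / n - u / n) * (b ^ 2 / n)) := by
        refine mul_le_mul_of_nonneg_left (h2.trans ?_) (by positivity)
        exact mul_le_mul_of_nonneg_left h1 (by linarith)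
    _ = b ^ 2 * (v - u) := by field_simp

/-- All normalized partial sums of the noise over grid intervals are bounded by `B`. -/
def NoiseBounded {n : ℕ} (ξ : Fin n → ℝ) (B : ℝ) : Prop :=
  ∀ u v : ℕ, u < v → v ≤ n → |blockSum ξ u v| ≤ B * √((v : ℝ) - u)

lemma localStat_le_iff {n : ℕ} (hn : 0 < n) (y : Fin n → ℝ) {u v : ℕ} (huv : u < v) (hv : v ≤ n)
    (c H : ℝ) : localStat y ((u : ℝ) / n, (v : ℝ) / n) c ≤ H ↔
      |blockSum y u v - ((v : ℝ) - u) * c| ≤ H * √((v : ℝ) - u) := by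
  have hvu : (0 : ℝ) < (v : ℝ) - u := by rw [sub_pos]; exact_mod_cast huv
  rw [localStat_eq hn y huv.le hv, one_div, inv_mul_le_iff₀ (Real.sqrt_pos.2 hvu), mul_comm H]

lemma IsNormalSystem.exists_nat {c : ℝ} {n : ℕ} {S : Set (ℝ × ℝ)} (hn : 0 < n)
    (hS : IsNormalSystem c n S) {I : ℝ × ℝ} (hI : I ∈ S) :
    ∃ u v : ℕ, u < v ∧ v ≤ n ∧ I = ((u : ℝ) / n, (v : ℝ) / n) := by
  have hn' : (0 : ℝ) < n := by exact_mod_cast hn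
  obtain ⟨⟨u, -, hu⟩, ⟨v, hv, hv'⟩⟩ := hS.onGrid I hI
  refine ⟨u, v, ?_, hv, Prod.ext hu hv'⟩
  have := (hS.isInterval I hI).2.1
  rw [hu, hv', div_lt_div_iff_of_pos_right hn'] at this
  exact_mod_cast this

lemma mem_Ico_div_iff {n : ℕ} (hn : 0 < n) {u v i : ℕ} :
    (i : ℝ) / n ∈ Ico ((u : ℝ) / n) ((v : ℝ) / n) ↔ i ∈ Finset.Ico u v := by
  have hn' : (0 : ℝ) < n := by exact_mod_cast hn
  rw [mem_Ico, div_le_div_iff_of_pos_right hn', div_lt_div_iff_of_pos_right hn']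
  simp

/-- If the noise is bounded, a piecewise constant function which is close to the truth on each of
its plateaus satisfies the multiscale side constraint. -/
lemma isFeasible_cellFun {n : ℕ} (hn : 0 < n) {S : Set (ℝ × ℝ)} {c : ℝ}
    (hS : IsNormalSystem c n S) {s : ℝ × ℝ → (ℝ → ℝ) → ℝ} {η b B D L : ℝ} (hb : 0 ≤ b)
    {f : ℝ → ℝ} {w : ℕ → ℝ} (hw : RunBound n f w b)
    (hfm : AEStronglyMeasurable f unitMeasure) (hfb : ∀ᵐ x ∂unitMeasure, |f x| ≤ L)
    {ξ : Fin n → ℝ} (hξ : NoiseBounded ξ B)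
    (hs : ∀ I ∈ S, ∀ g : ℝ → ℝ, IsCandidate n g → |s I g| ≤ D) (hη : B + b + D ≤ η) :
    IsFeasible S s η (observations n f ξ) (cellFun n w) := by
  have hcand : IsCandidate n (cellFun n w) :=
    ⟨isStep_cellFun hn w, changePoints_cellFun_subset_grid hn w⟩
  refine ⟨hcand, ?_⟩
  refine iSup₂_le fun I hI => iSup₂_le fun d hd => ?_
  rw [EReal.coe_le_coe_iff]
  obtain ⟨u, v, huv, hv, rfl⟩ := hS.exists_nat hn hI
  have hval : ∀ i ∈ Finset.Ico u v, w i = d := by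
    intro i hi
    rw [← hd _ ((mem_Ico_div_iff hn).2 hi)]
    refine (cellFun_eq hn w i ⟨le_rfl, ?_⟩).symm
    have hn' : (0 : ℝ) < n := by exact_mod_cast hn
    gcongr; linarith
  have hwu : w u = d := hval u (Finset.mem_Ico.2 ⟨le_rfl, huv⟩)
  have h1 := hw.abs_integral_le hb hfm hfb huv hv fun i hi => (hval i hi).trans hwu.symm
  have h2 := hξ u v huv hv
  have h3 := (abs_le.1 (hs _ hI _ hcand)).1
  have h4 : localStat (observations n f ξ) ((u : ℝ) / n, (v : ℝ) / n) d ≤ B + b := by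
    rw [localStat_le_iff hn _ huv hv, blockSum_observations
      (integrableOn_of_bound hfm hfb le_rfl le_rfl) ξ huv.le hv, ← hwu, add_sub_assoc]
    refine (abs_add_le _ _).trans ?_
    rw [add_mul]
    exact add_le_add h2 h1
  linarith

/-- The side constraint with bounded penalties controls the residuals on every interval of the
system on which the candidate is constant. -/
lemma IsFeasible.residual_le {n : ℕ} (hn : 0 < n) {S : Set (ℝ × ℝ)}
    {s : ℝ × ℝ → (ℝ → ℝ) → ℝ} {η D : ℝ} {y : Fin n → ℝ} {g : ℝ → ℝ} (hg : IsFeasible S s η y g)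
    (hs : ∀ I ∈ S, ∀ g : ℝ → ℝ, IsCandidate n g → |s I g| ≤ D) {u v : ℕ} (huv : u < v)
    (hv : v ≤ n) (hI : ((u : ℝ) / n, (v : ℝ) / n) ∈ S)
    (hc : ∀ i ∈ Finset.Ico u v, g ((i : ℝ) / n) = g ((u : ℝ) / n)) :
    |blockSum y u v - ((v : ℝ) - u) * g ((u : ℝ) / n)| ≤ (η + D) * √((v : ℝ) - u) := by
  have hn' : (0 : ℝ) < n := by exact_mod_cast hn
  rw [← localStat_le_iff hn _ huv hv]
  have hconst : ∀ x ∈ Ico ((u : ℝ) / n) ((v : ℝ) / n), g x = g ((u : ℝ) / n) := by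
    intro x hx
    have hx0 : 0 ≤ x := le_trans (by positivity) hx.1
    have hm := mem_cell_floor hn hx0
    have h1 : u ≤ ⌊(n : ℝ) * x⌋₊ := by
      rw [Nat.le_floor_iff (by positivity)]
      have := (div_le_iff₀ hn').1 hx.1
      linarith
    have h2 : ⌊(n : ℝ) * x⌋₊ < v := by
      rw [Nat.floor_lt (by positivity)]
      have := (lt_div_iff₀ hn').1 hx.2
      linarith
    rw [hg.1.eq_on_cell hn _ (h2.trans_le hv) x hm, hc _ (Finset.mem_Ico.2 ⟨h1, h2⟩)]
  have hle := (le_iSup₂ (f := fun (I : ℝ × ℝ) (_ : I ∈ S) =>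
    ⨆ (c : ℝ) (_ : ∀ x ∈ Ico I.1 I.2, g x = c), ((localStat y I c - s I g : ℝ) : EReal)) _ hI)
  have hle2 := (le_iSup₂ (f := fun (c : ℝ)
    (_ : ∀ x ∈ Ico ((u : ℝ) / n) ((v : ℝ) / n), g x = c) =>
    ((localStat y ((u : ℝ) / n, (v : ℝ) / n) c - s ((u : ℝ) / n, (v : ℝ) / n) g : ℝ) : EReal))
    _ hconst)
  have h := (hle2.trans hle).trans hg.2
  rw [EReal.coe_le_coe_iff] at h
  have := (abs_le.1 (hs _ hI g hg.1)).2
  linarith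

/-! ### The error of the estimator on the event of bounded noise -/

open Classical in
/-- An additive interval function which is at most `D` on runs without breaks is at most
`D` times one plus the number of breaks. -/
lemma le_card_breaks_mul {F : ℕ → ℕ → ℝ} {D : ℝ} {n : ℕ} (hn : 0 < n) (brk : ℕ → Prop)
    (h0 : F 0 0 = 0) (hadd : ∀ a b c, a ≤ b → b ≤ c → c ≤ n → F a c = F a b + F b c)
    (hrun : ∀ i₀ i₁, i₀ ≤ i₁ → i₁ < n → (∀ i ∈ Finset.Ioc i₀ i₁, ¬ brk i) →
      F i₀ (i₁ + 1) ≤ D) :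
    F 0 n ≤ ((((Finset.Ico 1 n).filter brk).card : ℝ) + 1) * D := by
  have key : ∀ i < n, ∃ i₀ ≤ i, (∀ j ∈ Finset.Ioc i₀ i, ¬ brk j) ∧
      F 0 i₀ ≤ (((Finset.Ico 1 (i + 1)).filter brk).card : ℝ) * D := by
    intro i
    induction i with
    | zero => intro _; exact ⟨0, le_rfl, by simp, by simp [h0]⟩
    | succ i ih =>
      intro hi
      obtain ⟨i₀, hi₀, hnb, hle⟩ := ih (by omega)
      have hins : Finset.Ico 1 (i + 1 + 1) = insert (i + 1) (Finset.Ico 1 (i + 1)) :=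
        (Finset.insert_Ico_right_eq_Ico_add_one (by omega)).symm
      by_cases hb : brk (i + 1)
      · refine ⟨i + 1, le_rfl, by simp, ?_⟩
        rw [hins, Finset.filter_insert, if_pos hb, Finset.card_insert_of_notMem (by simp),
          hadd 0 i₀ (i + 1) (by omega) (by omega) (by omega)]
        have := hrun i₀ i hi₀ (by omega) hnb
        push_cast
        linarith
      · refine ⟨i₀, by omega, ?_, ?_⟩
        · intro j hj
          obtain ⟨h1, h2⟩ := Finset.mem_Ioc.1 hj
          rcases Nat.lt_or_ge j (i + 1) with h | h
          · exact hnb j (Finset.mem_Ioc.2 ⟨h1, by omega⟩)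
          · rwa [show j = i + 1 by omega]
        · rwa [hins, Finset.filter_insert, if_neg hb]
  obtain ⟨i₀, hi₀, hnb, hle⟩ := key (n - 1) (by omega)
  have := hrun i₀ (n - 1) hi₀ (by omega) hnb
  rw [Nat.sub_add_cancel hn] at this hle
  rw [hadd 0 i₀ n (by omega) (by omega) le_rfl]
  linarith

lemma eq_of_forall_eq_pred {w : ℕ → ℝ} {u v : ℕ} (h : ∀ i ∈ Finset.Ioc u v, w i = w (i - 1)) :
    ∀ i, u ≤ i → i ≤ v → w i = w u := by
  intro i hi
  induction i, hi using Nat.le_induction with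
  | base => intro _; rfl
  | succ i hi ih =>
    intro h'
    rw [h (i + 1) (Finset.mem_Ioc.2 ⟨by omega, h'⟩), Nat.add_sub_cancel]
    exact ih (by omega)

/-- Richness of a normal system: every run of cells contains an interval of the system which is
not shorter by more than the factor `c`. -/
lemma IsNormalSystem.exists_subinterval {c : ℝ} {n : ℕ} {S : Set (ℝ × ℝ)} (hn : 0 < n) (hc : 1 < c)
    (hS : IsNormalSystem c n S) {i₀ i₁ : ℕ} (h01 : i₀ ≤ i₁) (h1 : i₁ < n) :
    ∃ u v : ℕ, i₀ ≤ u ∧ u < v ∧ v ≤ i₁ + 1 ∧ ((u : ℝ) / n, (v : ℝ) / n) ∈ S ∧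
      ((i₁ : ℝ) + 1 - i₀) ≤ c * ((v : ℝ) - u) := by
  have hn' : (0 : ℝ) < n := by exact_mod_cast hn
  have hc0 : 0 < c := by linarith
  rcases lt_or_ge c ((i₁ : ℝ) + 1 - i₀) with h | h
  · obtain ⟨I, hI, hsub, hlen⟩ := hS.rich ((i₀ : ℝ) / n) (((i₁ : ℝ) + 1) / n) (by positivity)
      (by rw [div_le_one hn']; exact_mod_cast h1)
      (by rw [← sub_div]; gcongr)
    obtain ⟨u, v, huv, hv, rfl⟩ := hS.exists_nat hn hI
    have hlt : (u : ℝ) / n < (v : ℝ) / n := by gcongr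
    obtain ⟨h3, h4⟩ := (Ico_subset_Ico_iff hlt).1 hsub
    rw [div_le_div_iff_of_pos_right hn'] at h3 h4
    refine ⟨u, v, by exact_mod_cast h3, huv, by exact_mod_cast h4, hI, ?_⟩
    have h5 : c⁻¹ * (((i₁ : ℝ) + 1) / n - i₀ / n) ≤ (v : ℝ) / n - u / n := hlen
    rw [← sub_div, ← sub_div, ← mul_div_assoc, div_le_div_iff_of_pos_right hn',
      inv_mul_le_iff₀ hc0] at h5
    exact h5
  · refine ⟨i₀, i₀ + 1, le_rfl, by omega, by omega, ?_, ?_⟩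
    · have := hS.cells i₀ (by omega)
      push_cast
      exact this
    · push_cast; linarith

/-- On a common plateau of a feasible candidate `g` and of an approximation `w` of the truth, the
two values differ by `O(|R|^{-1/2})`, since both are close to the local mean of the data on some
interval of the system inside the plateau. -/
lemma IsFeasible.plateau_dist {n : ℕ} (hn : 0 < n) {S : Set (ℝ × ℝ)} {c : ℝ} (hc : 1 < c)
    (hS : IsNormalSystem c n S) {s : ℝ × ℝ → (ℝ → ℝ) → ℝ} {η b B D L : ℝ} (hb : 0 ≤ b)
    {f g : ℝ → ℝ} {w : ℕ → ℝ} (hw : RunBound n f w b)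
    (hfm : AEStronglyMeasurable f unitMeasure) (hfb : ∀ᵐ x ∂unitMeasure, |f x| ≤ L)
    {ξ : Fin n → ℝ} (hξ : NoiseBounded ξ B) (hg : IsFeasible S s η (observations n f ξ) g)
    (hs : ∀ I ∈ S, ∀ g : ℝ → ℝ, IsCandidate n g → |s I g| ≤ D)
    {i₀ i₁ : ℕ} (h01 : i₀ ≤ i₁) (h1 : i₁ < n)
    (hcw : ∀ i ∈ Finset.Ioc i₀ i₁, w i = w (i - 1))
    (hcg : ∀ i ∈ Finset.Ioc i₀ i₁, g ((i : ℝ) / n) = g (((i - 1 : ℕ) : ℝ) / n)) :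
    ((i₁ : ℝ) + 1 - i₀) * (w i₀ - g ((i₀ : ℝ) / n)) ^ 2 ≤ c * (η + D + B + b) ^ 2 := by
  obtain ⟨u, v, hu, huv, hv, hI, hlen⟩ := hS.exists_subinterval hn hc h01 h1
  have hw' := eq_of_forall_eq_pred hcw
  have hg' := eq_of_forall_eq_pred (w := fun i : ℕ => g ((i : ℝ) / n)) hcg
  have hvn : v ≤ n := by omega
  have e1 := hw.abs_integral_le hb hfm hfb huv hvn fun i hi => by
    obtain ⟨h3, h4⟩ := Finset.mem_Ico.1 hi
    rw [hw' i (by omega) (by omega), hw' u hu (by omega)]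
  have e2 := hξ u v huv hvn
  have e3 := hg.residual_le hn hs huv hvn hI fun i hi => by
    obtain ⟨h3, h4⟩ := Finset.mem_Ico.1 hi
    rw [hg' i (by omega) (by omega), hg' u hu (by omega)]
  rw [blockSum_observations (integrableOn_of_bound hfm hfb le_rfl le_rfl) ξ huv.le hvn,
    hg' u hu (by omega)] at e3
  rw [hw' u hu (by omega)] at e1
  have hvu : (0 : ℝ) < (v : ℝ) - u := by rw [sub_pos]; exact_mod_cast huv
  set r := √((v : ℝ) - u) with hr
  have hr2 : r ^ 2 = (v : ℝ) - u := Real.sq_sqrt hvu.le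
  have hr0 : 0 < r := Real.sqrt_pos.2 hvu
  set d := w i₀ - g ((i₀ : ℝ) / n) with hd
  have e4 : |((v : ℝ) - u) * d| ≤ (η + D + B + b) * r := by
    have : ((v : ℝ) - u) * d =
        (blockSum ξ u v + n * (∫ x in Ico ((u : ℝ) / n) ((v : ℝ) / n), f x) -
          ((v : ℝ) - u) * g ((i₀ : ℝ) / n)) - blockSum ξ u v -
        (n * (∫ x in Ico ((u : ℝ) / n) ((v : ℝ) / n), f x) - ((v : ℝ) - u) * w i₀) := by
      rw [hd]; ring
    rw [this]
    refine (abs_sub _ _).trans ((add_le_add (abs_sub _ _) le_rfl).trans ?_)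
    linarith
  have e5 : r * |d| ≤ η + D + B + b := by
    rw [abs_mul, abs_of_pos hvu, ← hr2] at e4
    have : r * (r * |d|) ≤ r * (η + D + B + b) := by nlinarith
    exact le_of_mul_le_mul_left this hr0
  have e6 : ((v : ℝ) - u) * d ^ 2 ≤ (η + D + B + b) ^ 2 := by
    rw [← hr2, ← sq_abs d, ← mul_pow]
    gcongr
  calc ((i₁ : ℝ) + 1 - i₀) * d ^ 2 ≤ c * ((v : ℝ) - u) * d ^ 2 := by gcongr
    _ = c * (((v : ℝ) - u) * d ^ 2) := by ring
    _ ≤ _ := by gcongr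

/-- Whatever the noise, the values of a feasible candidate are bounded by means of the constraints
on the single cells. -/
lemma IsFeasible.abs_value_le {n : ℕ} {S : Set (ℝ × ℝ)} {c : ℝ}
    (hS : IsNormalSystem c n S) {s : ℝ × ℝ → (ℝ → ℝ) → ℝ} {η D L : ℝ}
    {f g : ℝ → ℝ} (hfb : ∀ᵐ x ∂unitMeasure, |f x| ≤ L)
    {ξ : Fin n → ℝ} (hg : IsFeasible S s η (observations n f ξ) g)
    (hs : ∀ I ∈ S, ∀ g : ℝ → ℝ, IsCandidate n g → |s I g| ≤ D) (i : Fin n) :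
    |g ((i : ℕ) / n)| ≤ L + |ξ i| + (η + D) := by
  have hn : 0 < n := by have := i.isLt; omega
  have hn' : (0 : ℝ) < n := by exact_mod_cast hn
  have hend : ((i : ℕ) + 1 : ℝ) / n ≤ 1 := by rw [div_le_one hn']; exact_mod_cast i.isLt
  have hst : (0 : ℝ) ≤ ((i : ℕ) : ℝ) / n := by positivity
  have h := hg.residual_le hn hs (u := i) (v := i + 1) (by omega) i.isLt
    (by have := hS.cells i i.isLt; push_cast; exact this) (by
      intro j hj
      obtain ⟨h1, h2⟩ := Finset.mem_Ico.1 hj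
      rw [show j = i by omega])
  rw [blockSum_succ _ le_rfl i.isLt, blockSum_self, zero_add] at h
  push_cast at h
  rw [add_sub_cancel_left, one_mul, Real.sqrt_one, mul_one] at h
  have hmean : |n * ∫ x in Ico (((i : ℕ) : ℝ) / n) ((((i : ℕ) : ℝ) + 1) / n), f x| ≤ L := by
    have := norm_setIntegral_le_of_norm_le_const_ae (μ := volume) (C := L) (f := f)
      (s := Ico (((i : ℕ) : ℝ) / n) ((((i : ℕ) : ℝ) + 1) / n)) (by simp)
      (ae_restrict_Ico_of_unitMeasure hfb hst hend)
    rw [Real.norm_eq_abs, measureReal_def, Real.volume_Ico, ENNReal.toReal_ofReal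
      (by rw [← sub_div, add_sub_cancel_left]; positivity), ← sub_div, add_sub_cancel_left] at this
    rw [abs_mul, abs_of_pos hn']
    calc (n : ℝ) * |∫ x in Ico (((i : ℕ) : ℝ) / n) ((((i : ℕ) : ℝ) + 1) / n), f x|
        ≤ n * (L * (1 / n)) := by gcongr
      _ = L := by field_simp
  rw [observations] at h
  have e : g (((i : ℕ) : ℝ) / n) =
      n * (∫ x in Ico (((i : ℕ) : ℝ) / n) ((((i : ℕ) : ℝ) + 1) / n), f x) + ξ i -
      (n * (∫ x in Ico (((i : ℕ) : ℝ) / n) ((((i : ℕ) : ℝ) + 1) / n), f x) + ξ i -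
        g (((i : ℕ) : ℝ) / n)) := by ring
  rw [e]
  refine (abs_sub _ _).trans ?_
  have := abs_add_le (n * (∫ x in Ico (((i : ℕ) : ℝ) / n) ((((i : ℕ) : ℝ) + 1) / n), f x)) (ξ i)
  linarith

open Classical in
/-- The squared error of a feasible candidate `g` is governed by the number of its jumps and those
of a good approximation `w` of the truth. -/
lemma IsFeasible.integral_sq_le {n : ℕ} (hn : 0 < n) {S : Set (ℝ × ℝ)} {c : ℝ} (hc : 1 < c)
    (hS : IsNormalSystem c n S) {s : ℝ × ℝ → (ℝ → ℝ) → ℝ} {η b B D L : ℝ} (hb : 0 ≤ b)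
    {f g : ℝ → ℝ} {w : ℕ → ℝ} (hw : RunBound n f w b)
    (hfm : AEStronglyMeasurable f unitMeasure) (hfb : ∀ᵐ x ∂unitMeasure, |f x| ≤ L)
    {ξ : Fin n → ℝ} (hξ : NoiseBounded ξ B) (hg : IsFeasible S s η (observations n f ξ) g)
    (hs : ∀ I ∈ S, ∀ g : ℝ → ℝ, IsCandidate n g → |s I g| ≤ D) {m : ℝ}
    (hwm : (((Finset.Ico 1 n).filter fun i => w i ≠ w (i - 1)).card : ℝ) ≤ m)
    (hgm : (((Finset.Ico 1 n).filter fun i : ℕ =>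
      g ((i : ℝ) / n) ≠ g (((i - 1 : ℕ) : ℝ) / n)).card : ℝ) ≤ m)
    (hgint : IntegrableOn (fun x => (f x - g x) ^ 2) (Ico 0 1)) :
    ∫ x in Ico (0 : ℝ) 1, (f x - g x) ^ 2 ≤
      (2 * m + 1) * ((2 * b ^ 2 + 2 * (c * (η + D + B + b) ^ 2)) / n) := by
  have hn' : (0 : ℝ) < n := by exact_mod_cast hn
  obtain ⟨brk, hbrk⟩ : ∃ brk : ℕ → Prop, ∀ i, brk i ↔
      w i ≠ w (i - 1) ∨ g ((i : ℝ) / n) ≠ g (((i - 1 : ℕ) : ℝ) / n) := ⟨_, fun i => Iff.rfl⟩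
  have hle1 : ∀ {i : ℕ}, i ≤ n → (i : ℝ) / n ≤ 1 := fun h => by
    rw [div_le_one hn']; exact_mod_cast h
  have key := le_card_breaks_mul (F := fun i j : ℕ =>
    ∫ x in Ico ((i : ℝ) / n) ((j : ℝ) / n), (f x - g x) ^ 2)
    (D := (2 * b ^ 2 + 2 * (c * (η + D + B + b) ^ 2)) / n) hn brk (by simp)
    (by
      intro i j k hij hjk hk
      exact setIntegral_Ico_add (by gcongr) (by gcongr)
        (hgint.mono_set (Ico_subset_Ico (by positivity) (hle1 hk))))
    (by
      intro i₀ i₁ h01 h1 hnb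
      simp only [hbrk, not_or, not_not] at hnb
      have hcw := fun i hi => (hnb i hi).1
      have hcg := fun i hi => (hnb i hi).2
      have hpd := hg.plateau_dist hn hc hS hb hw hfm hfb hξ hs h01 h1 hcw hcg
      have hrb := hw i₀ i₁ h01 h1 hcw
      have hg' := eq_of_forall_eq_pred (w := fun i : ℕ => g ((i : ℝ) / n)) hcg
      have hst : (0 : ℝ) ≤ (i₀ : ℝ) / n := by positivity
      have hend : ((i₁ : ℝ) + 1) / n ≤ 1 := by
        have := hle1 (i := i₁ + 1) h1
        push_cast at this; exact this
      have hlen : (i₀ : ℝ) / n ≤ ((i₁ : ℝ) + 1) / n := by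
        have : (i₀ : ℝ) ≤ i₁ := by exact_mod_cast h01
        gcongr; linarith
      have hgc : ∀ x ∈ Ico ((i₀ : ℝ) / n) (((i₁ : ℝ) + 1) / n), g x = g ((i₀ : ℝ) / n) := by
        intro x hx
        have hx0 : 0 ≤ x := hst.trans hx.1
        have h3 : i₀ ≤ ⌊(n : ℝ) * x⌋₊ := by
          rw [Nat.le_floor_iff (by positivity)]
          have := (div_le_iff₀ hn').1 hx.1
          linarith
        have h4 : ⌊(n : ℝ) * x⌋₊ < i₁ + 1 := by
          rw [Nat.floor_lt (by positivity)]
          have := (lt_div_iff₀ hn').1 hx.2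
          push_cast; linarith
        rw [hg.1.eq_on_cell hn _ (by omega) x (mem_cell_floor hn hx0)]
        exact hg' _ h3 (by omega)
      set d := w i₀ - g ((i₀ : ℝ) / n) with hd
      have hI := integrableOn_sq_sub_const hfm hfb (w i₀) hst hend
      show ∫ x in Ico ((i₀ : ℝ) / n) (((i₁ + 1 : ℕ) : ℝ) / n), (f x - g x) ^ 2 ≤ _
      push_cast
      calc ∫ x in Ico ((i₀ : ℝ) / n) (((i₁ : ℝ) + 1) / n), (f x - g x) ^ 2
          ≤ ∫ x in Ico ((i₀ : ℝ) / n) (((i₁ : ℝ) + 1) / n), (2 * (f x - w i₀) ^ 2 + 2 * d ^ 2) := by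
            refine setIntegral_mono_on (hgint.mono_set (Ico_subset_Ico hst hend))
              ((hI.const_mul 2).add (integrableOn_const (by simp))) measurableSet_Ico
              fun x hx => ?_
            rw [hgc x hx]
            have : f x - g ((i₀ : ℝ) / n) = (f x - w i₀) + d := by rw [hd]; ring
            rw [this]
            show _ ≤ 2 * (f x - w i₀) ^ 2 + 2 * d ^ 2
            nlinarith [sq_nonneg (f x - w i₀ - d)]
        _ = 2 * (∫ x in Ico ((i₀ : ℝ) / n) (((i₁ : ℝ) + 1) / n), (f x - w i₀) ^ 2) +
            2 * ((((i₁ : ℝ) + 1) - i₀) * d ^ 2) / n := by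
            rw [integral_add (hI.const_mul 2) (integrableOn_const (by simp)), integral_const_mul,
              setIntegral_const, smul_eq_mul, measureReal_def, Real.volume_Ico,
              ENNReal.toReal_ofReal (by linarith)]
            ring
        _ ≤ 2 * (b ^ 2 / n) + 2 * (c * (η + D + B + b) ^ 2) / n := by gcongr
        _ = _ := by ring)
  have hcard : ((((Finset.Ico 1 n).filter brk).card : ℝ) + 1) ≤ 2 * m + 1 := by
    have h1 : ((Finset.Ico 1 n).filter brk).card ≤
        ((Finset.Ico 1 n).filter fun i => w i ≠ w (i - 1)).card +
        ((Finset.Ico 1 n).filter fun i : ℕ =>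
          g ((i : ℝ) / n) ≠ g (((i - 1 : ℕ) : ℝ) / n)).card := by
      refine (Finset.card_le_card fun i hi => ?_).trans (Finset.card_union_le _ _)
      obtain ⟨h1, h2⟩ := Finset.mem_filter.1 hi
      rw [Finset.mem_union, Finset.mem_filter, Finset.mem_filter]
      exact ((hbrk i).1 h2).imp (fun h => ⟨h1, h⟩) fun h => ⟨h1, h⟩
    have h2 : ((((Finset.Ico 1 n).filter brk).card : ℕ) : ℝ) ≤ _ := Nat.cast_le.2 h1
    push_cast at h2
    linarith
  simp only [Nat.cast_zero, zero_div, div_self hn'.ne'] at key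
  refine key.trans (mul_le_mul_of_nonneg_right hcard ?_)
  positivity

lemma ae_abs_sub_le {n : ℕ} (hn : 0 < n) {f g : ℝ → ℝ} {L M : ℝ} (hg : IsCandidate n g)
    (hfb : ∀ᵐ x ∂unitMeasure, |f x| ≤ L) (hM : ∀ i : Fin n, |g ((i : ℕ) / n)| ≤ M) :
    ∀ᵐ x ∂unitMeasure, |g x - f x| ≤ M + L := by
  filter_upwards [hfb, ae_restrict_mem measurableSet_Ico] with x hx hxm
  have h1 := floor_lt_of_mem hn hxm
  rw [hg.eq_on_cell hn _ h1 x (mem_cell_floor hn hxm.1)]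
  exact (abs_sub _ _).trans (add_le_add (hM ⟨_, h1⟩) hx)

/-- On the event that the noise is bounded, the estimator is close to the truth in `L²` and, up to
a logarithmic factor, bounded. The bounds are uniform over the approximation class. -/
lemma exists_error_bound {γ L c δ a t : ℝ} {q : ℝ≥0∞} (hγ : 0 < γ) (hL : 0 < L) (hq : 2 ≤ q)
    (hc : 1 < c) (ht : 0 < t) (hδ : 0 < δ) (ha : δ + t < a) :
    ∃ K : ℝ, 1 ≤ K ∧ ∀ᶠ n : ℕ in atTop, ∀ S : Set (ℝ × ℝ), IsNormalSystem c n S →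
      ∀ f ∈ approxClass γ q L, ∀ (ξ : Fin n → ℝ) (s : ℝ × ℝ → (ℝ → ℝ) → ℝ) (fhat : ℝ → ℝ),
      IsSegmentation S s δ (a * √(Real.log n)) (observations n f ξ) fhat →
      NoiseBounded ξ (t * √(Real.log n)) →
      ∫ x in Ico (0 : ℝ) 1, (fhat x - f x) ^ 2 ≤ K * (jumpScale γ n * Real.log n / n) ∧
      ∀ᵐ x ∂unitMeasure, |fhat x - f x| ≤ K * √(Real.log n) := by
  classical
  set ε := a - δ - t with hε
  have hε0 : 0 < ε := by rw [hε]; linarith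
  obtain ⟨C, hC, hcand⟩ := exists_candidate (q := q) hγ hL hε0 hq
  set K₁ := (2 * C + 1) * (2 * ε ^ 2 + 2 * (c * (a + δ + t + ε) ^ 2)) with hK₁
  set K₂ := 2 * L + t + a + δ with hK₂
  refine ⟨1 + max K₁ K₂, ?_, ?_⟩
  · have : 0 ≤ K₂ := by rw [hK₂]; linarith
    linarith [le_max_right K₁ K₂]
  filter_upwards [hcand, eventually_le_log 1] with n hcand h1 S hS f hf ξ s fhat hseg hξ
  have hn := pos_of_one_le_log h1
  have hn' : (0 : ℝ) < n := by exact_mod_cast hn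
  obtain ⟨w, hwcard, hwrun⟩ := hcand f hf
  obtain ⟨hs, hfeas, hmin⟩ := hseg
  have hfm := aestronglyMeasurable_of_mem_approxClass hf
  have hfb := ae_abs_le_of_mem_approxClass hL.le hf
  set l := Real.log n with hl
  have hl0 : 0 ≤ l := by linarith
  have hsl : 1 ≤ √l := Real.one_le_sqrt.2 h1
  have hb : 0 ≤ ε * √l := by positivity
  have hwfeas := isFeasible_cellFun (η := a * √l) (B := t * √l) hn hS hb hwrun hfm hfb hξ hs
    (by rw [hε]; nlinarith)
  have hjump : (((Finset.Ico 1 n).filter fun i : ℕ =>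
      fhat ((i : ℝ) / n) ≠ fhat (((i - 1 : ℕ) : ℝ) / n)).card : ℝ) ≤ C * jumpScale γ n := by
    refine le_trans ?_ hwcard
    have h2 := (card_filter_le_numJumps hn (w := fun i : ℕ => fhat ((i : ℝ) / n))
      (hfeas.1.eq_on_cell hn)).trans ((hmin _ hwfeas).trans (numJumps_cellFun_le hn w))
    exact_mod_cast h2
  have hval : ∀ i : Fin n, |fhat ((i : ℕ) / n)| ≤ L + t * √l + (a * √l + δ * √l) := by
    intro i
    refine (hfeas.abs_value_le hS hfb hs i).trans ?_
    have h3 := hξ i (i + 1) (by omega) i.isLt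
    rw [blockSum_succ _ le_rfl i.isLt, blockSum_self, zero_add] at h3
    push_cast at h3
    rw [add_sub_cancel_left, Real.sqrt_one, mul_one] at h3
    simp only [Fin.eta] at h3
    linarith
  have hsup := ae_abs_sub_le hn hfeas.1 hfb hval
  have hbd : ∀ᵐ x ∂unitMeasure, |fhat x - f x| ≤ K₂ * √l := by
    filter_upwards [hsup] with x hx
    refine hx.trans ?_
    rw [hK₂]; nlinarith
  have hgm : AEStronglyMeasurable fhat unitMeasure :=
    (aemeasurable_of_rightCont hfeas.1.1.continuousWithinAt).aestronglyMeasurable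
  have hint : IntegrableOn (fun x => (f x - fhat x) ^ 2) (Ico 0 1) := by
    have : Integrable (fun x => (f x - fhat x) ^ 2) unitMeasure := by
      refine Integrable.of_bound (C := (K₂ * √l) ^ 2) ((hfm.sub hgm).pow 2) ?_
      filter_upwards [hbd] with x hx
      rw [Real.norm_eq_abs, abs_of_nonneg (sq_nonneg _), ← sq_abs, abs_sub_comm]
      gcongr
    exact this
  refine ⟨?_, ?_⟩
  · have hmain := hfeas.integral_sq_le hn hc hS hb hwrun hfm hfb hξ hs hwcard hjump hint
    have hκ := one_le_jumpScale hγ h1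
    calc ∫ x in Ico (0 : ℝ) 1, (fhat x - f x) ^ 2
        = ∫ x in Ico (0 : ℝ) 1, (f x - fhat x) ^ 2 := by
          congr 1; ext x; ring
      _ ≤ _ := hmain
      _ = (2 * C * jumpScale γ n + 1) * ((2 * ε ^ 2 + 2 * (c * (a + δ + t + ε) ^ 2)) * l / n) := by
          have e1 : a * √l + δ * √l + t * √l + ε * √l = (a + δ + t + ε) * √l := by ring
          rw [e1, mul_pow, mul_pow, Real.sq_sqrt hl0]; ring
      _ ≤ ((2 * C + 1) * jumpScale γ n) *
          ((2 * ε ^ 2 + 2 * (c * (a + δ + t + ε) ^ 2)) * l / n) := by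
          have : 0 < c := by linarith
          refine mul_le_mul_of_nonneg_right (by linarith) (by positivity)
      _ = K₁ * (jumpScale γ n * l / n) := by rw [hK₁]; ring
      _ ≤ _ := by
          refine mul_le_mul_of_nonneg_right (by linarith [le_max_left K₁ K₂]) ?_
          have : 0 ≤ jumpScale γ n := by linarith
          positivity
  · filter_upwards [hbd] with x hx
    refine hx.trans (mul_le_mul_of_nonneg_right ?_ (by positivity))
    linarith [le_max_right K₁ K₂]

/-! ### From the squared error to the rate in `L^p` -/

lemma invRate_pos {γ p : ℝ} {n : ℕ} (hn : 1 ≤ Real.log n) : 0 < invRate γ p n := by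
  have hn' : (0 : ℝ) < n := by exact_mod_cast pos_of_one_le_log hn
  exact mul_pos (Real.rpow_pos_of_pos (by linarith) _) (Real.rpow_pos_of_pos hn' _)

lemma invRate_eq_max (γ : ℝ) {p : ℝ} (hp : 0 < p) (n : ℕ) :
    invRate γ p n = invRate γ (max p 2) n := by
  rcases le_total p 2 with h | h
  · have h1 : 1 / 2 ≤ 1 / p := one_div_le_one_div_of_le hp h
    rw [max_eq_right h, invRate, invRate, max_eq_right (by linarith), min_eq_left h1]
    simp
  · rw [max_eq_left h]

/-- For `p ≥ 2` the rate balances the bound for the `p`-th power of the error. -/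
lemma invRate_mul_eq_one {γ p : ℝ} (hγ : 0 < γ) (hp : 2 ≤ p) {n : ℕ} (hn : 1 ≤ Real.log n) :
    invRate γ p n * (√(Real.log n) ^ (p - 2) * (jumpScale γ n * Real.log n / n)) ^ (1 / p) = 1 := by
  have hn' : (0 : ℝ) < n := by exact_mod_cast pos_of_one_le_log hn
  have hl : 0 < Real.log n := by linarith
  have h1 : 1 / p ≤ 1 / 2 := one_div_le_one_div_of_le (by norm_num) hp
  rw [invRate, jumpScale, max_eq_left (by linarith), min_eq_right h1]
  set l := Real.log n with hldef
  have hp0 : 0 < p := by linarith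
  have hg0 : 2 * γ + 1 ≠ 0 := by positivity
  have e1 : l = Real.exp (Real.log l) := (Real.exp_log hl).symm
  have e2 : (n : ℝ) = Real.exp l := (Real.exp_log hn').symm
  set x := Real.log l with hx
  rw [e2, Real.sqrt_eq_rpow, e1]
  simp only [← Real.exp_mul, ← Real.exp_add, ← Real.exp_sub]
  rw [Real.exp_eq_one_iff]
  field_simp
  ring

lemma invRate_le {γ p : ℝ} (hγ : 0 < γ) {n : ℕ} (hn : 1 ≤ Real.log n) :
    invRate γ p n ≤ (n : ℝ) ^ (1 / 2 : ℝ) := by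
  have hn1 : (1 : ℝ) ≤ n := by exact_mod_cast pos_of_one_le_log hn
  have h1 : Real.log n ^ (-((γ + max (1 / 2 - 1 / p) 0) / (2 * γ + 1))) ≤ 1 := by
    refine Real.rpow_le_one_of_one_le_of_nonpos hn (neg_nonpos.2 (div_nonneg ?_ (by positivity)))
    have := le_max_right (1 / 2 - 1 / p) 0
    linarith
  have h2 : (n : ℝ) ^ (2 * γ / (2 * γ + 1) * min (1 / 2) (1 / p)) ≤ (n : ℝ) ^ (1 / 2 : ℝ) := by
    refine Real.rpow_le_rpow_of_exponent_le hn1 ?_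
    have h3 : 2 * γ / (2 * γ + 1) ≤ 1 := by rw [div_le_one (by positivity)]; linarith
    have h4 : 0 ≤ 2 * γ / (2 * γ + 1) := by positivity
    calc 2 * γ / (2 * γ + 1) * min (1 / 2) (1 / p) ≤ 2 * γ / (2 * γ + 1) * (1 / 2) :=
          mul_le_mul_of_nonneg_left (min_le_left _ _) h4
      _ ≤ 1 * (1 / 2) := by gcongr
      _ = 1 / 2 := one_mul _
  calc invRate γ p n ≤ 1 * (n : ℝ) ^ (1 / 2 : ℝ) := by
        rw [invRate]
        exact mul_le_mul h1 h2 (by positivity) zero_le_one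
    _ = _ := one_mul _

/-- Interpolation between the squared error and the supremum bound gives the rate in `L^p`. -/
lemma invRate_mul_lpNorm_le {γ p K : ℝ} (hγ : 0 < γ) (hp : 0 < p) (hK : 1 ≤ K) {n : ℕ}
    (hn : 1 ≤ Real.log n) {F : ℝ → ℝ} (hF : AEStronglyMeasurable F unitMeasure)
    (h2 : ∫ x in Ico (0 : ℝ) 1, F x ^ 2 ≤ K * (jumpScale γ n * Real.log n / n))
    (hsup : ∀ᵐ x ∂unitMeasure, |F x| ≤ K * √(Real.log n)) :
    lpNorm F (ENNReal.ofReal p) ≤ ENNReal.ofReal (K / invRate γ p n) := by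
  set P := max p 2 with hP
  have hP2 : 2 ≤ P := le_max_right _ _
  have hP0 : 0 < P := by linarith
  have hn' : (0 : ℝ) < n := by exact_mod_cast pos_of_one_le_log hn
  have hl : 0 < Real.log n := by linarith
  have hsl : 0 < √(Real.log n) := Real.sqrt_pos.2 hl
  have hκ : 0 < jumpScale γ n := by have := one_le_jumpScale hγ hn; linarith
  have hstep : lpNorm F (ENNReal.ofReal p) ≤ lpNorm F (ENNReal.ofReal P) :=
    eLpNorm_le_eLpNorm_of_exponent_le (ENNReal.ofReal_le_ofReal (le_max_left _ _)) hF
  refine hstep.trans ?_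
  have hmem : ∀ s : ℝ≥0∞, MemLp F s unitMeasure := fun s =>
    MemLp.of_bound hF (K * √(Real.log n)) (by simpa using hsup)
  rw [lpNorm, (hmem _).eLpNorm_eq_integral_rpow_norm (by simpa using hP0) (by simp),
    ENNReal.toReal_ofReal hP0.le]
  refine ENNReal.ofReal_le_ofReal ?_
  set A := √(Real.log n) ^ (P - 2) * (jumpScale γ n * Real.log n / n) with hA
  have hA0 : 0 < A := by positivity
  have hint : ∫ x, ‖F x‖ ^ P ∂unitMeasure ≤ K ^ P * A := by
    have hle : ∀ᵐ x ∂unitMeasure, ‖F x‖ ^ P ≤ (K * √(Real.log n)) ^ (P - 2) * F x ^ 2 := by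
      filter_upwards [hsup] with x hx
      rw [Real.norm_eq_abs]
      calc |F x| ^ P = |F x| ^ (P - 2) * |F x| ^ 2 := by
            rw [← Real.rpow_natCast |F x| 2, ← Real.rpow_add_of_nonneg (abs_nonneg _)
              (by linarith) (by norm_num)]
            congr 1; push_cast; ring
        _ ≤ (K * √(Real.log n)) ^ (P - 2) * |F x| ^ 2 := by
            gcongr
        _ = _ := by rw [sq_abs]
    have hPi : Integrable (fun x => ‖F x‖ ^ P) unitMeasure := by
      have := (hmem (ENNReal.ofReal P)).integrable_norm_rpow (by simpa using hP0) (by simp)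
      rwa [ENNReal.toReal_ofReal hP0.le] at this
    calc ∫ x, ‖F x‖ ^ P ∂unitMeasure
        ≤ ∫ x, (K * √(Real.log n)) ^ (P - 2) * F x ^ 2 ∂unitMeasure :=
          integral_mono_ae hPi ((hmem 2).integrable_sq.const_mul _) hle
      _ = (K * √(Real.log n)) ^ (P - 2) * ∫ x in Ico (0 : ℝ) 1, F x ^ 2 := by
          rw [integral_const_mul, unitMeasure]
      _ ≤ (K * √(Real.log n)) ^ (P - 2) * (K * (jumpScale γ n * Real.log n / n)) := by gcongr
      _ = K ^ (P - 1) * A := by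
          have e : K ^ (P - 1) = K ^ (P - 2) * K := by
            rw [← Real.rpow_add_one (by linarith)]; congr 1; ring
          rw [Real.mul_rpow (by linarith) hsl.le, hA, e]; ring
      _ ≤ K ^ P * A := by
          gcongr
          linarith
  have hI0 : 0 ≤ ∫ x, ‖F x‖ ^ P ∂unitMeasure :=
    integral_nonneg fun x => Real.rpow_nonneg (norm_nonneg _) _
  calc (∫ x, ‖F x‖ ^ P ∂unitMeasure) ^ P⁻¹ ≤ (K ^ P * A) ^ P⁻¹ := by gcongr
    _ = K * A ^ (1 / P) := by
        rw [Real.mul_rpow (by positivity) hA0.le, ← Real.rpow_mul (by linarith),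
          mul_inv_cancel₀ hP0.ne', Real.rpow_one, one_div]
    _ = K / invRate γ p n := by
        have h := invRate_mul_eq_one hγ hP2 hn
        rw [invRate_eq_max γ hp, eq_div_iff (invRate_pos hn).ne', mul_assoc,
          mul_comm (A ^ (1 / P)), h, mul_one]

/-! ### Maximal inequality and tail bound for the noise -/

lemma measurable_blockSum {Ω : Type*} {m : MeasurableSpace Ω} {n : ℕ} {ξ : Fin n → Ω → ℝ}
    {u v : ℕ} (h : ∀ i : Fin n, u ≤ (i : ℕ) → (i : ℕ) < v → Measurable (ξ i)) :
    Measurable fun ω => blockSum (fun i => ξ i ω) u v := by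
  unfold blockSum
  refine Finset.measurable_sum _ fun i hi => ?_
  obtain ⟨-, h1, h2⟩ := Finset.mem_filter.1 hi
  exact h i h1 h2

lemma lintegral_exp_le {Ω : Type*} [MeasurableSpace Ω] {P : Measure Ω} {X : Ω → ℝ} {τ : ℝ≥0}
    (hX : HasSubgaussianMGF X τ P) (z : ℝ) :
    ∫⁻ ω, ENNReal.ofReal (Real.exp (z * X ω)) ∂P ≤ ENNReal.ofReal (Real.exp (τ * z ^ 2 / 2)) := by
  rw [← ofReal_integral_eq_lintegral_ofReal (hX.integrable_exp_mul z)
    (Eventually.of_forall fun ω => (Real.exp_pos _).le)]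
  exact ENNReal.ofReal_le_ofReal (hX.mgf_le z)

/-- Exponential maximal inequality for the partial sums `S_k` of independent variables. The
potential `1_{A_k} + 1_{A_kᶜ} e^{z (S_k - x) + (l - k) b}`, where `A_k` is the event that the level
`x` was reached up to time `k`, has decreasing expectation. -/
lemma measure_exists_blockSum_ge_le {Ω : Type*} [MeasurableSpace Ω] {P : Measure Ω}
    [IsProbabilityMeasure P] {n : ℕ} {ξ : Fin n → Ω → ℝ} (hmeas : ∀ i, Measurable (ξ i))
    (hind : iIndepFun ξ P) {z b x : ℝ} (hz : 0 ≤ z) (hb : 0 ≤ b)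
    (hexp : ∀ i, ∫⁻ ω, ENNReal.ofReal (Real.exp (z * ξ i ω)) ∂P ≤ ENNReal.ofReal (Real.exp b))
    {u l : ℕ} (hul : u + l ≤ n) :
    P {ω | ∃ k ≤ l, x ≤ blockSum (fun i => ξ i ω) u (u + k)} ≤
      ENNReal.ofReal (Real.exp (-(z * x) + l * b)) := by
  classical
  set S : ℕ → Ω → ℝ := fun k ω => blockSum (fun i => ξ i ω) u (u + k) with hS
  set A : ℕ → Set Ω := fun k => {ω | ∃ j ≤ k, x ≤ S j ω} with hA
  set W : ℕ → ℝ → Ω → ℝ≥0∞ := fun k d ω => ENNReal.ofReal (Real.exp (z * (S k ω - x) + d))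
  have hSm : ∀ k, Measurable (S k) := fun k => measurable_blockSum fun i _ _ => hmeas i
  have hAm : ∀ k, MeasurableSet (A k) := fun k => by
    have : A k = ⋃ j ∈ Finset.range (k + 1), {ω | x ≤ S j ω} := by
      ext ω; simp [hA]
    rw [this]
    exact Finset.measurableSet_biUnion _ fun j _ => measurableSet_le measurable_const (hSm j)
  have hWm : ∀ k d, Measurable (W k d) := fun k d =>
    ((((hSm k).sub_const x).const_mul z).add_const d).exp.ennreal_ofReal
  set Φ : ℕ → ℝ≥0∞ := fun k =>
    P (A k) + ∫⁻ ω, (A k)ᶜ.indicator (W k (((l : ℝ) - k) * b)) ω ∂P with hΦ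
  have hstep : ∀ k < l, Φ (k + 1) ≤ Φ k := by
    intro k hk
    have hkn : u + k < n := by omega
    set i₀ : Fin n := ⟨u + k, hkn⟩ with hi₀
    have hSsucc : ∀ ω, S (k + 1) ω = S k ω + ξ i₀ ω := fun ω => by
      simp only [hS]
      exact blockSum_succ (fun i => ξ i ω) (Nat.le_add_right u k) hkn
    set d : ℝ := ((l : ℝ) - (k + 1)) * b with hd
    set h : Ω → ℝ≥0∞ := (A k)ᶜ.indicator (W k d) with hh
    have hpt : ∀ ω, (A (k + 1)).indicator 1 ω + (A (k + 1))ᶜ.indicator (W (k + 1) d) ω ≤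
        (A k).indicator 1 ω + h ω * ENNReal.ofReal (Real.exp (z * ξ i₀ ω)) := by
      intro ω
      have hprod : W k d ω * ENNReal.ofReal (Real.exp (z * ξ i₀ ω)) = W (k + 1) d ω := by
        simp only [W]
        rw [← ENNReal.ofReal_mul (Real.exp_pos _).le, ← Real.exp_add, hSsucc]
        congr 2; ring
      by_cases h1 : ω ∈ A k
      · have h2 : ω ∈ A (k + 1) := by
          obtain ⟨j, hj, hx⟩ := h1; exact ⟨j, by omega, hx⟩
        simp [h1, h2, hh]
      · by_cases h2 : ω ∈ A (k + 1)
        · have hx : x ≤ S (k + 1) ω := by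
            obtain ⟨j, hj, hx⟩ := h2
            rcases Nat.lt_or_ge j (k + 1) with h | h
            · exact absurd ⟨j, by omega, hx⟩ h1
            · rwa [show k + 1 = j by omega]
          have hW1 : 1 ≤ W (k + 1) d ω := by
            simp only [W]
            rw [ENNReal.one_le_ofReal, Real.one_le_exp_iff]
            have hk' : (0 : ℝ) ≤ (l : ℝ) - (k + 1) := by
              rw [sub_nonneg]; exact_mod_cast hk
            have := mul_nonneg hz (sub_nonneg.2 hx)
            have := mul_nonneg hk' hb
            linarith
          simpa [h1, h2, hh, hprod] using hW1
        · simp [h1, h2, hh, hprod]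
    -- the potential at time `k` is measurable with respect to the variables before `ξ i₀`
    have hprod : ∫⁻ ω, h ω * ENNReal.ofReal (Real.exp (z * ξ i₀ ω)) ∂P =
        (∫⁻ ω, h ω ∂P) * ∫⁻ ω, ENNReal.ofReal (Real.exp (z * ξ i₀ ω)) ∂P := by
      set m : Fin n → MeasurableSpace Ω := fun i => MeasurableSpace.comap (ξ i) inferInstance
      have hm : ∀ i, m i ≤ _ := fun i => (hmeas i).comap_le
      set T : Set (Fin n) := {i | (i : ℕ) < u + k}
      have hdisj : Disjoint T {i₀} := by
        rw [Set.disjoint_singleton_right]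
        simp [T, hi₀]
      have hindep : Indep (⨆ i ∈ T, m i) (⨆ i ∈ ({i₀} : Set (Fin n)), m i) P :=
        indep_iSup_of_disjoint hm hind.iIndep hdisj
      have hξT : ∀ i ∈ T, Measurable[⨆ i ∈ T, m i] (ξ i) := fun i hi =>
        (comap_measurable (ξ i)).mono (le_iSup₂ (f := fun i (_ : i ∈ T) => m i) i hi) le_rfl
      have hST : ∀ j ≤ k, Measurable[⨆ i ∈ T, m i] (S j) := fun j hj =>
        measurable_blockSum (m := ⨆ i ∈ T, m i) fun i _ h2 =>
          hξT i (show (i : ℕ) < u + k by omega)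
      have hAT : MeasurableSet[⨆ i ∈ T, m i] (A k) := by
        have : A k = ⋃ j ∈ Finset.range (k + 1), {ω | x ≤ S j ω} := by
          ext ω; simp [hA]
        rw [this]
        refine Finset.measurableSet_biUnion _ fun j hj => ?_
        exact hST j (Nat.lt_succ_iff.1 (Finset.mem_range.1 hj)) measurableSet_Ici
      have hWT : Measurable[⨆ i ∈ T, m i] (W k d) :=
        (Measurable.add_const (Measurable.const_mul (Measurable.sub_const (hST k le_rfl) x) z)
          d).exp.ennreal_ofReal
      refine lintegral_mul_eq_lintegral_mul_lintegral_of_independent_measurableSpace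
        (iSup₂_le fun i _ => hm i) (iSup₂_le fun i _ => hm i) hindep
        (hWT.indicator hAT.compl) ?_
      have : Measurable[⨆ i ∈ ({i₀} : Set (Fin n)), m i] (ξ i₀) :=
        (comap_measurable (ξ i₀)).mono
          (le_iSup₂ (f := fun i (_ : i ∈ ({i₀} : Set (Fin n))) => m i) i₀ rfl) le_rfl
      exact (Measurable.const_mul this z).exp.ennreal_ofReal
    have hcomb : (∫⁻ ω, h ω ∂P) * ENNReal.ofReal (Real.exp b) =
        ∫⁻ ω, (A k)ᶜ.indicator (W k (((l : ℝ) - k) * b)) ω ∂P := by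
      rw [← lintegral_mul_const _ ((hWm k d).indicator (hAm k).compl)]
      congr 1; ext ω
      by_cases h1 : ω ∈ A k
      · simp [h1]
      · simp only [mem_compl_iff, h1, not_false_eq_true, indicator_of_mem, W]
        rw [← ENNReal.ofReal_mul (Real.exp_pos _).le, ← Real.exp_add]
        congr 2; rw [hd]; ring
    calc Φ (k + 1) = ∫⁻ ω, ((A (k + 1)).indicator 1 ω +
          (A (k + 1))ᶜ.indicator (W (k + 1) d) ω) ∂P := by
          rw [lintegral_add_left (measurable_one.indicator (hAm _)),
            lintegral_indicator_one (hAm _)]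
          simp only [hΦ, hd]; push_cast; rfl
      _ ≤ ∫⁻ ω, ((A k).indicator 1 ω + h ω * ENNReal.ofReal (Real.exp (z * ξ i₀ ω))) ∂P :=
          lintegral_mono hpt
      _ = P (A k) + (∫⁻ ω, h ω ∂P) * ∫⁻ ω, ENNReal.ofReal (Real.exp (z * ξ i₀ ω)) ∂P := by
          rw [lintegral_add_left (measurable_one.indicator (hAm _)),
            lintegral_indicator_one (hAm _), hprod]
      _ ≤ P (A k) + (∫⁻ ω, h ω ∂P) * ENNReal.ofReal (Real.exp b) := by gcongr; exact hexp i₀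
      _ = Φ k := by rw [hcomb]
  have hdec : ∀ k ≤ l, Φ k ≤ Φ 0 := by
    intro k
    induction k with
    | zero => intro _; exact le_rfl
    | succ k ih => intro hk; exact (hstep k (by omega)).trans (ih (by omega))
  have h0 : Φ 0 ≤ ENNReal.ofReal (Real.exp (-(z * x) + l * b)) := by
    have hS0 : ∀ ω, S 0 ω = 0 := fun ω => by simp [hS, blockSum_self]
    by_cases hx : x ≤ 0
    · have : A 0 = univ := by ext ω; simp [hA, hS0, hx]
      simp only [hΦ, this, measure_univ, compl_univ, indicator_empty, lintegral_zero, add_zero]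
      rw [ENNReal.one_le_ofReal, Real.one_le_exp_iff]
      have : (0 : ℝ) ≤ l * b := by positivity
      nlinarith
    · have : A 0 = ∅ := by ext ω; simp [hA, hS0]; linarith
      simp only [hΦ, this, measure_empty, zero_add, compl_empty, indicator_univ, W, hS0]
      rw [lintegral_const, measure_univ, mul_one]
      refine le_of_eq ?_
      congr 2; push_cast; ring
  calc P (A l) ≤ Φ l := le_self_add
    _ ≤ Φ 0 := hdec l le_rfl
    _ ≤ _ := h0

/-- Sub-Gaussian maximal inequality for the modulus of the partial sums. -/
lemma measure_exists_abs_blockSum_ge_le {Ω : Type*} [MeasurableSpace Ω] {P : Measure Ω}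
    [IsProbabilityMeasure P] {n : ℕ} {ξ : Fin n → Ω → ℝ} (hmeas : ∀ i, Measurable (ξ i))
    (hind : iIndepFun ξ P) {τ : ℝ≥0} (hτ : 0 < τ) (hsub : ∀ i, HasSubgaussianMGF (ξ i) τ P)
    {x : ℝ} (hx : 0 ≤ x) {u l : ℕ} (hl : 0 < l) (hul : u + l ≤ n) :
    P {ω | ∃ k ≤ l, x ≤ |blockSum (fun i => ξ i ω) u (u + k)|} ≤
      ENNReal.ofReal (2 * Real.exp (-(x ^ 2 / (2 * τ * l)))) := by
  have hτ' : (0 : ℝ) < τ := by exact_mod_cast hτ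
  have hl' : (0 : ℝ) < l := by exact_mod_cast hl
  -- the optimal exponent
  set z : ℝ := x / (τ * l) with hz
  have hz0 : 0 ≤ z := by positivity
  have hopt : -(z * x) + l * (τ * z ^ 2 / 2) = -(x ^ 2 / (2 * τ * l)) := by
    rw [hz]; field_simp; ring
  have h1 := measure_exists_blockSum_ge_le (x := x) hmeas hind hz0
    (by positivity : (0 : ℝ) ≤ τ * z ^ 2 / 2) (fun i => lintegral_exp_le (hsub i) z) hul
  have h2 := measure_exists_blockSum_ge_le (ξ := fun i ω => -ξ i ω) (x := x)
    (fun i => (hmeas i).neg) (hind.comp (fun _ y => -y) fun _ => measurable_neg) hz0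
    (by positivity : (0 : ℝ) ≤ τ * z ^ 2 / 2) (fun i => lintegral_exp_le (hsub i).neg z) hul
  rw [hopt] at h1 h2
  have hneg : ∀ (ω : Ω) (v : ℕ), blockSum (fun i => -ξ i ω) u v =
      -blockSum (fun i => ξ i ω) u v := fun ω v => by
    simp only [blockSum, Finset.sum_neg_distrib]
  refine (measure_mono ?_).trans ((measure_union_le _ _).trans ((add_le_add h1 h2).trans ?_))
  · rintro ω ⟨k, hk, hxk⟩
    rcases le_abs.1 hxk with h | h
    · exact Or.inl ⟨k, hk, h⟩
    · refine Or.inr ⟨k, hk, ?_⟩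
      rwa [hneg]
  · rw [← ENNReal.ofReal_add (Real.exp_pos _).le (Real.exp_pos _).le, ← two_mul]

/-- The probability that some normalized partial sum of the noise over a grid interval exceeds
`t √(log n)`. Intervals are grouped by their left end-point and by their length on a geometric
scale with ratio `ρ`, so that only `O(n log n)` maximal inequalities are needed. -/
lemma measure_not_noiseBounded_le {Ω : Type*} [MeasurableSpace Ω] {P : Measure Ω}
    [IsProbabilityMeasure P] {n : ℕ} (hn : 0 < n) {ξ : Fin n → Ω → ℝ}
    (hmeas : ∀ i, Measurable (ξ i)) (hind : iIndepFun ξ P) {τ : ℝ≥0} (hτ : 0 < τ)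
    (hsub : ∀ i, HasSubgaussianMGF (ξ i) τ P) {t ρ : ℝ} (ht : 0 ≤ t) (hρ : 1 < ρ) :
    P {ω | ¬ NoiseBounded (fun i => ξ i ω) (t * √(Real.log n))} ≤
      ENNReal.ofReal (n * (Real.log n / Real.log ρ + 1) *
        (2 * (n : ℝ) ^ (-(t ^ 2 / (2 * τ * ρ))))) := by
  have hn' : (0 : ℝ) < n := by exact_mod_cast hn
  have hτ' : (0 : ℝ) < τ := by exact_mod_cast hτ
  have hlogρ : 0 < Real.log ρ := Real.log_pos hρ
  have hlogn : 0 ≤ Real.log n := Real.log_natCast_nonneg n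
  set J := ⌊Real.log n / Real.log ρ⌋₊ with hJ
  set x : ℕ → ℝ := fun j => t * √(Real.log n) * √(ρ ^ j) with hx
  set l : ℕ → ℕ → ℕ := fun u j => min ⌊ρ ^ (j + 1)⌋₊ (n - u) with hl
  set E : ℕ → ℕ → Set Ω := fun u j =>
    {ω | ∃ k ≤ l u j, x j ≤ |blockSum (fun i => ξ i ω) u (u + k)|} with hE
  have hsubset : {ω | ¬ NoiseBounded (fun i => ξ i ω) (t * √(Real.log n))} ⊆
      ⋃ u ∈ Finset.range n, ⋃ j ∈ Finset.range (J + 1), E u j := by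
    intro ω hω
    simp only [mem_ofPred_eq, NoiseBounded, not_forall, not_le] at hω
    obtain ⟨u, v, huv, hv, hgt⟩ := hω
    obtain ⟨m, rfl⟩ : ∃ m, v = u + m := ⟨v - u, by omega⟩
    have hm : 1 ≤ m := by omega
    have hm' : (1 : ℝ) ≤ m := by exact_mod_cast hm
    obtain ⟨j, hj1, hj2⟩ := exists_nat_pow_near hm' hρ
    have hjJ : j ≤ J := by
      rw [hJ, Nat.le_floor_iff (by positivity), le_div_iff₀ hlogρ, ← Real.log_pow]
      refine Real.log_le_log (by positivity) (hj1.trans ?_)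
      exact_mod_cast (by omega : m ≤ n)
    simp only [mem_iUnion, Finset.mem_range, exists_prop]
    refine ⟨u, by omega, j, by omega, m, ?_, ?_⟩
    · refine le_min (Nat.le_floor hj2.le) (by omega)
    · refine le_trans ?_ hgt.le
      simp only [hx]
      have : ((u + m : ℕ) : ℝ) - u = m := by push_cast; ring
      rw [this]
      gcongr
  have hEle : ∀ u ∈ Finset.range n, ∀ j ∈ Finset.range (J + 1),
      P (E u j) ≤ ENNReal.ofReal (2 * (n : ℝ) ^ (-(t ^ 2 / (2 * τ * ρ)))) := by
    intro u hu j _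
    have hu := Finset.mem_range.1 hu
    have hpow : (1 : ℝ) ≤ ρ ^ (j + 1) := one_le_pow₀ hρ.le
    have hl0 : 0 < l u j := lt_min (Nat.floor_pos.2 hpow) (by omega)
    have hlle : (l u j : ℝ) ≤ ρ ^ (j + 1) :=
      (Nat.cast_le.2 (min_le_left _ _)).trans (Nat.floor_le (by positivity))
    have hul : u + l u j ≤ n := by
      have : l u j ≤ n - u := min_le_right _ _
      omega
    have hl0' : (0 : ℝ) < l u j := by exact_mod_cast hl0
    refine (measure_exists_abs_blockSum_ge_le hmeas hind hτ hsub
      (by simp only [hx]; positivity) hl0 hul).trans (ENNReal.ofReal_le_ofReal ?_)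
    rw [Real.rpow_def_of_pos hn']
    refine mul_le_mul_of_nonneg_left (Real.exp_le_exp.2 ?_) (by norm_num)
    have hxsq : x j ^ 2 = t ^ 2 * Real.log n * ρ ^ j := by
      simp only [hx]
      rw [mul_pow, mul_pow, Real.sq_sqrt hlogn, Real.sq_sqrt (by positivity)]
    rw [hxsq, mul_neg, neg_le_neg_iff, ← mul_div_assoc, div_le_div_iff₀ (by positivity)
      (by positivity)]
    calc Real.log n * t ^ 2 * (2 * τ * l u j)
        ≤ Real.log n * t ^ 2 * (2 * τ * ρ ^ (j + 1)) := by gcongr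
      _ = t ^ 2 * Real.log n * ρ ^ j * (2 * τ * ρ) := by rw [pow_succ]; ring
  set e := ENNReal.ofReal (2 * (n : ℝ) ^ (-(t ^ 2 / (2 * τ * ρ)))) with he
  calc P {ω | ¬ NoiseBounded (fun i => ξ i ω) (t * √(Real.log n))}
      ≤ P (⋃ u ∈ Finset.range n, ⋃ j ∈ Finset.range (J + 1), E u j) := measure_mono hsubset
    _ ≤ ∑ u ∈ Finset.range n, ∑ j ∈ Finset.range (J + 1), P (E u j) :=
        (measure_biUnion_finset_le _ _).trans
          (Finset.sum_le_sum fun u _ => measure_biUnion_finset_le _ _)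
    _ ≤ ∑ u ∈ Finset.range n, ∑ j ∈ Finset.range (J + 1), e :=
        Finset.sum_le_sum fun u hu => Finset.sum_le_sum fun j hj => hEle u hu j hj
    _ = ENNReal.ofReal (n * (J + 1) * (2 * (n : ℝ) ^ (-(t ^ 2 / (2 * τ * ρ))))) := by
        rw [ENNReal.ofReal_mul (by positivity), ENNReal.ofReal_mul hn'.le, ← he,
          ENNReal.ofReal_natCast, show ((J : ℝ) + 1) = ((J + 1 : ℕ) : ℝ) by push_cast; rfl,
          ENNReal.ofReal_natCast]
        simp [mul_assoc]
    _ ≤ _ := by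
        refine ENNReal.ofReal_le_ofReal ?_
        have : (J : ℝ) ≤ Real.log n / Real.log ρ := Nat.floor_le (by positivity)
        gcongr

/-- Since `t > σ √(2r + 4)`, there is room for a ratio `ρ > 1` of the length scale, and the
exceptional event of unbounded noise has summable probability `O(n^{-1-3r/4})`. -/
lemma exists_tail_bound {Ω : Type*} [MeasurableSpace Ω] {P : Measure Ω}
    [IsProbabilityMeasure P] {ξ : (n : ℕ) → Fin n → Ω → ℝ}
    (hmeas : ∀ n i, Measurable (ξ n i)) (hind : ∀ n, iIndepFun (ξ n) P) {τ : ℝ≥0} (hτ : 0 < τ)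
    (hsub : ∀ n i, HasSubgaussianMGF (ξ n i) τ P) {t r : ℝ} (ht : 0 ≤ t) (hr : 0 < r)
    (htr : τ * (2 * r + 4) < t ^ 2) :
    ∃ C : ℝ, 0 ≤ C ∧ ∀ n : ℕ, 0 < n →
      P {ω | ¬ NoiseBounded (fun i => ξ n i ω) (t * √(Real.log n))} ≤
        ENNReal.ofReal (C * (n : ℝ) ^ (-(1 + 3 * r / 4))) := by
  have hτ' : (0 : ℝ) < τ := by exact_mod_cast hτ
  set ρ := t ^ 2 / (τ * (2 * r + 4)) with hρ
  have hρ1 : 1 < ρ := by rw [hρ, one_lt_div (by positivity)]; exact htr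
  have hlogρ : 0 < Real.log ρ := Real.log_pos hρ1
  have hρe : t ^ 2 / (2 * τ * ρ) = r + 2 := by
    have hpos : 0 < t ^ 2 := lt_trans (by positivity) htr
    have ht0 : t ≠ 0 := fun h => by simp [h] at hpos
    rw [hρ]; field_simp; ring
  refine ⟨2 * (1 / (r / 4) / Real.log ρ + 1), by positivity, fun n hn => ?_⟩
  refine (measure_not_noiseBounded_le hn (hmeas n) (hind n) hτ (hsub n) ht hρ1).trans
    (ENNReal.ofReal_le_ofReal ?_)
  have hn' : (0 : ℝ) < n := by exact_mod_cast hn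
  have hn1 : (1 : ℝ) ≤ n := by exact_mod_cast hn
  rw [hρe]
  have hlog : Real.log n ≤ (n : ℝ) ^ (r / 4) / (r / 4) :=
    Real.log_le_rpow_div hn'.le (by positivity)
  have h1 : (1 : ℝ) ≤ (n : ℝ) ^ (r / 4) := Real.one_le_rpow hn1 (by positivity)
  have hsplit : (n : ℝ) ^ (-(1 + 3 * r / 4)) = n * (n : ℝ) ^ (r / 4) * (n : ℝ) ^ (-(r + 2)) := by
    rw [mul_comm (n : ℝ), ← Real.rpow_add_one hn'.ne', ← Real.rpow_add hn']
    congr 1; ring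
  calc n * (Real.log n / Real.log ρ + 1) * (2 * (n : ℝ) ^ (-(r + 2)))
      ≤ n * ((n : ℝ) ^ (r / 4) / (r / 4) / Real.log ρ + (n : ℝ) ^ (r / 4)) *
          (2 * (n : ℝ) ^ (-(r + 2))) := by gcongr
    _ = 2 * (1 / (r / 4) / Real.log ρ + 1) * (n : ℝ) ^ (-(1 + 3 * r / 4)) := by
        rw [hsplit]; ring

lemma pow_abs_le (M : ℕ) (y : ℝ) :
    |y| ^ M ≤ M.factorial * (Real.exp (1 * y) + Real.exp (1 * -y)) := by
  have h1 := Real.pow_div_factorial_le_exp |y| (abs_nonneg y) M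
  rw [div_le_iff₀ (by positivity), mul_comm] at h1
  refine h1.trans (mul_le_mul_of_nonneg_left ?_ (by positivity))
  rw [one_mul, one_mul]
  rcases abs_cases y with ⟨h, -⟩ | ⟨h, -⟩ <;> rw [h]
  · linarith [Real.exp_pos (-y)]
  · linarith [Real.exp_pos y]

lemma lintegral_pow_abs_le {Ω : Type*} [MeasurableSpace Ω] {P : Measure Ω} {X : Ω → ℝ} {τ : ℝ≥0}
    (hm : Measurable X) (hX : HasSubgaussianMGF X τ P) (M : ℕ) :
    ∫⁻ ω, ENNReal.ofReal (|X ω| ^ M) ∂P ≤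
      ENNReal.ofReal (M.factorial * (2 * Real.exp (τ / 2))) := by
  have h1 := lintegral_exp_le hX 1
  have h2 := lintegral_exp_le hX.neg 1
  rw [one_pow, mul_one] at h1 h2
  calc ∫⁻ ω, ENNReal.ofReal (|X ω| ^ M) ∂P
      ≤ ∫⁻ ω, ENNReal.ofReal M.factorial * (ENNReal.ofReal (Real.exp (1 * X ω)) +
          ENNReal.ofReal (Real.exp (1 * (-X) ω))) ∂P := by
        refine lintegral_mono fun ω => ?_
        rw [← ENNReal.ofReal_add (Real.exp_pos _).le (Real.exp_pos _).le,
          ← ENNReal.ofReal_mul (by positivity)]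
        exact ENNReal.ofReal_le_ofReal (pow_abs_le M (X ω))
    _ = ENNReal.ofReal M.factorial * (∫⁻ ω, ENNReal.ofReal (Real.exp (1 * X ω)) ∂P +
          ∫⁻ ω, ENNReal.ofReal (Real.exp (1 * (-X) ω)) ∂P) := by
        rw [lintegral_const_mul', lintegral_add_left]
        · exact (hm.const_mul 1).exp.ennreal_ofReal
        · exact ENNReal.ofReal_ne_top
    _ ≤ ENNReal.ofReal M.factorial * (ENNReal.ofReal (Real.exp (τ / 2)) +
          ENNReal.ofReal (Real.exp (τ / 2))) := by gcongr
    _ = _ := by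
        rw [← ENNReal.ofReal_add (Real.exp_pos _).le (Real.exp_pos _).le,
          ← ENNReal.ofReal_mul (by positivity), two_mul (Real.exp _)]

/-! ### The risk -/

lemma sqrt_log_le {n : ℕ} (hn : 0 < n) : √(Real.log n) ≤ 2 * (n : ℝ) ^ (1 / 4 : ℝ) := by
  have hn' : (0 : ℝ) < n := by exact_mod_cast hn
  have h := Real.log_le_rpow_div hn'.le (by norm_num : (0 : ℝ) < 1 / 2)
  have e : ((n : ℝ) ^ (1 / 4 : ℝ)) ^ 2 = (n : ℝ) ^ (1 / 2 : ℝ) := by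
    rw [← Real.rpow_natCast, ← Real.rpow_mul hn'.le]; norm_num
  refine Real.sqrt_le_iff.2 ⟨by positivity, h.trans ?_⟩
  rw [mul_pow, e]
  have : 0 ≤ (n : ℝ) ^ (1 / 2 : ℝ) := by positivity
  linarith

/-- A bound of the `r`-th power of the error, which is affine in the maximal modulus of the
noise, by the level `n^{1/4}` and high moments of the noise variables. -/
lemma rpow_le_of_le_max {n : ℕ} (hn : 0 < n) {ξ : Fin n → ℝ} {r B e : ℝ} (hr : 0 < r)
    (hB : 0 ≤ B) (he : 0 ≤ e) {M : ℕ} (hM : r ≤ M)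
    (h : ∀ y, (∀ i, |ξ i| ≤ y) → (n : ℝ) ^ (1 / 4 : ℝ) ≤ y → e ≤ B * y) :
    e ^ r ≤ B ^ r * ((n : ℝ) ^ (r / 4) +
      ∑ i, (n : ℝ) ^ (-((M - r) / 4)) * |ξ i| ^ M) := by
  have hn' : (0 : ℝ) < n := by exact_mod_cast hn
  have hT : 0 < (n : ℝ) ^ (1 / 4 : ℝ) := by positivity
  have hsum : 0 ≤ ∑ i, (n : ℝ) ^ (-((M - r) / 4)) * |ξ i| ^ M :=
    Finset.sum_nonneg fun i _ => by positivity
  by_cases hall : ∀ i, |ξ i| ≤ (n : ℝ) ^ (1 / 4 : ℝ)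
  · have h1 := h _ hall le_rfl
    calc e ^ r ≤ (B * (n : ℝ) ^ (1 / 4 : ℝ)) ^ r := by gcongr
      _ = B ^ r * (n : ℝ) ^ (r / 4) := by
          rw [Real.mul_rpow hB hT.le, ← Real.rpow_mul hn'.le]; congr 2; ring
      _ ≤ _ := by gcongr; linarith
  · push Not at hall
    obtain ⟨j, hj⟩ := hall
    have : Nonempty (Fin n) := ⟨j⟩
    obtain ⟨k, hk⟩ := Finite.exists_max fun i => |ξ i|
    have hkT : (n : ℝ) ^ (1 / 4 : ℝ) ≤ |ξ k| := hj.le.trans (hk j)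
    have hk0 : 0 < |ξ k| := hT.trans_le hkT
    have h1 := h _ hk hkT
    have h2 : |ξ k| ^ r ≤ (n : ℝ) ^ (-((M - r) / 4)) * |ξ k| ^ M := by
      have h3 : (n : ℝ) ^ ((M - r) / 4) ≤ |ξ k| ^ (M - r) := by
        calc (n : ℝ) ^ ((M - r) / 4) = ((n : ℝ) ^ (1 / 4 : ℝ)) ^ (M - r) := by
              rw [← Real.rpow_mul hn'.le]; congr 1; ring
          _ ≤ _ := Real.rpow_le_rpow hT.le hkT (by linarith)
      rw [Real.rpow_neg hn'.le, ← div_eq_inv_mul, le_div_iff₀ (by positivity)]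
      calc |ξ k| ^ r * (n : ℝ) ^ ((M - r) / 4) ≤ |ξ k| ^ r * |ξ k| ^ (M - r) := by gcongr
        _ = |ξ k| ^ M := by
            rw [← Real.rpow_add hk0, ← Real.rpow_natCast]; congr 1; ring
    calc e ^ r ≤ (B * |ξ k|) ^ r := by gcongr
      _ = B ^ r * |ξ k| ^ r := Real.mul_rpow hB hk0.le
      _ ≤ B ^ r * ∑ i, (n : ℝ) ^ (-((M - r) / 4)) * |ξ i| ^ M := by
          gcongr
          exact h2.trans (Finset.single_le_sum
            (f := fun i => (n : ℝ) ^ (-((M - r) / 4)) * |ξ i| ^ M)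
            (fun i _ => by positivity) (Finset.mem_univ k))
      _ ≤ _ := by
          gcongr
          have : 0 ≤ (n : ℝ) ^ (r / 4) := by positivity
          linarith

/-- Whatever the noise, the error of the estimator grows at most linearly in the size of the
noise. -/
lemma IsSegmentation.lpNorm_le {n : ℕ} (hn : 0 < n) {S : Set (ℝ × ℝ)} {c : ℝ}
    (hS : IsNormalSystem c n S) {s : ℝ × ℝ → (ℝ → ℝ) → ℝ} {δ a L : ℝ} (hδ : 0 ≤ δ) (ha : 0 ≤ a)
    (hL : 0 ≤ L) {f g : ℝ → ℝ} (hfb : ∀ᵐ x ∂unitMeasure, |f x| ≤ L) {ξ : Fin n → ℝ}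
    (hg : IsSegmentation S s δ (a * √(Real.log n)) (observations n f ξ) g) (p : ℝ≥0∞) {y : ℝ}
    (hy : ∀ i, |ξ i| ≤ y) (hny : (n : ℝ) ^ (1 / 4 : ℝ) ≤ y) :
    lpNorm (fun x => g x - f x) p ≤ ENNReal.ofReal ((2 * L + 1 + 2 * (a + δ)) * y) := by
  have hn1 : (1 : ℝ) ≤ n := by exact_mod_cast hn
  have hy1 : 1 ≤ y := (Real.one_le_rpow hn1 (by norm_num)).trans hny
  have hlog := sqrt_log_le hn
  have hval : ∀ i : Fin n, |g ((i : ℕ) / n)| ≤ L + (1 + 2 * (a + δ)) * y := by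
    intro i
    refine (hg.2.1.abs_value_le hS hfb hg.1 i).trans ?_
    have h1 := hy i
    have h2 : (a + δ) * √(Real.log n) ≤ (a + δ) * (2 * y) := by gcongr; linarith
    linarith
  have hsup := ae_abs_sub_le hn hg.2.1.1 hfb hval
  have hbd : ∀ᵐ x ∂unitMeasure, ‖g x - f x‖ ≤ (2 * L + 1 + 2 * (a + δ)) * y := by
    filter_upwards [hsup] with x hx
    rw [Real.norm_eq_abs]
    nlinarith
  have := eLpNorm_le_of_ae_bound (p := p) hbd
  simpa [lpNorm] using this

/-- The `r`-th moment of an error which is at most `A` on the event of bounded noise, and in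
general at most linear in the noise. The choice of `M` makes the sum of the `n` moments of order
`M` contribute `O(n^{-r/2})`, which is negligible as the normalising factor is at most `n^{1/2}`. -/
lemma lintegral_rpow_le {Ω : Type*} [MeasurableSpace Ω] {P : Measure Ω} [IsProbabilityMeasure P]
    {n : ℕ} (hn : 0 < n) {ξ : Fin n → Ω → ℝ} (hmeas : ∀ i, Measurable (ξ i)) {τ : ℝ≥0}
    (hsub : ∀ i, HasSubgaussianMGF (ξ i) τ P) {r A B C : ℝ} (hr : 0 < r) (hA : 0 ≤ A) (hB : 0 ≤ B)
    (hC : 0 ≤ C) {bad : Set Ω}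
    (hbad : P bad ≤ ENNReal.ofReal (C * (n : ℝ) ^ (-(1 + 3 * r / 4)))) {err : Ω → ℝ≥0∞}
    (hgood : ∀ᵐ ω ∂P, ω ∉ bad → err ω ≤ ENNReal.ofReal A)
    (hany : ∀ᵐ ω ∂P, ∀ y, (∀ i, |ξ i ω| ≤ y) → (n : ℝ) ^ (1 / 4 : ℝ) ≤ y →
      err ω ≤ ENNReal.ofReal (B * y)) {M : ℕ} (hM : 3 * r + 4 ≤ M) :
    ∫⁻ ω, err ω ^ r ∂P ≤ ENNReal.ofReal
      (A ^ r + B ^ r * (M.factorial * (2 * Real.exp (τ / 2)) + C) * (n : ℝ) ^ (-(r / 2))) := by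
  have hn' : (0 : ℝ) < n := by exact_mod_cast hn
  have hn1 : (1 : ℝ) ≤ n := by exact_mod_cast hn
  set m : ℝ := M.factorial * (2 * Real.exp (τ / 2)) with hm
  have hm0 : 0 ≤ m := by positivity
  set κ : ℝ := B ^ r * (n : ℝ) ^ (-((M - r) / 4)) with hκ
  have hκ0 : 0 ≤ κ := by positivity
  set Z : Ω → ℝ≥0∞ := fun ω => ∑ i, ENNReal.ofReal κ * ENNReal.ofReal (|ξ i ω| ^ M) with hZ
  have hterm : ∀ i, Measurable fun ω => ENNReal.ofReal κ * ENNReal.ofReal (|ξ i ω| ^ M) :=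
    fun i => ((((hmeas i).abs).pow_const M).ennreal_ofReal).const_mul _
  have hZm : Measurable Z := Finset.measurable_sum _ fun i _ => hterm i
  have hpt : ∀ᵐ ω ∂P, err ω ^ r ≤ ENNReal.ofReal (A ^ r) +
      (Z ω + bad.indicator (fun _ => ENNReal.ofReal (B ^ r * (n : ℝ) ^ (r / 4))) ω) := by
    filter_upwards [hgood, hany] with ω h1 h2
    by_cases hω : ω ∈ bad
    · refine le_trans ?_ le_add_self
      have hfin : err ω ≠ ∞ := by
        refine ne_top_of_le_ne_top ENNReal.ofReal_ne_top
          (h2 ((n : ℝ) ^ (1 / 4 : ℝ) + ∑ i, |ξ i ω|) (fun i => ?_) ?_)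
        · have := Finset.single_le_sum (f := fun i => |ξ i ω|) (fun i _ => abs_nonneg _)
            (Finset.mem_univ i)
          have h0 : 0 ≤ (n : ℝ) ^ (1 / 4 : ℝ) := by positivity
          exact this.trans (by linarith)
        · have := Finset.sum_nonneg fun (i : Fin n) (_ : i ∈ Finset.univ) => abs_nonneg (ξ i ω)
          linarith
      have h3 := rpow_le_of_le_max hn (ξ := fun i => ξ i ω) hr hB
        (ENNReal.toReal_nonneg (a := err ω)) (M := M) (by linarith) fun y hy1 hy2 =>
        ENNReal.toReal_le_of_le_ofReal (mul_nonneg hB (le_trans (by positivity) hy2))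
          (h2 y hy1 hy2)
      have h4 : err ω ^ r = ENNReal.ofReal ((err ω).toReal ^ r) := by
        rw [← ENNReal.ofReal_rpow_of_nonneg ENNReal.toReal_nonneg hr.le, ENNReal.ofReal_toReal hfin]
      rw [h4, indicator_of_mem hω]
      refine (ENNReal.ofReal_le_ofReal h3).trans (le_of_eq ?_)
      rw [hZ, mul_add, add_comm, ENNReal.ofReal_add (by positivity) (by positivity),
        Finset.mul_sum, ENNReal.ofReal_sum_of_nonneg (fun i _ => by positivity)]
      congr 1
      refine Finset.sum_congr rfl fun i _ => ?_
      rw [← ENNReal.ofReal_mul hκ0, hκ, mul_assoc]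
    · refine le_trans ?_ le_self_add
      rw [← ENNReal.ofReal_rpow_of_nonneg hA hr.le]
      exact ENNReal.rpow_le_rpow (h1 hω) hr.le
  have hZint : ∫⁻ ω, Z ω ∂P ≤ ENNReal.ofReal (B ^ r * m * (n : ℝ) ^ (-(r / 2))) := by
    rw [hZ, lintegral_finsetSum _ fun i _ => hterm i]
    calc ∑ i : Fin n, ∫⁻ ω, ENNReal.ofReal κ * ENNReal.ofReal (|ξ i ω| ^ M) ∂P
        ≤ ∑ _i : Fin n, ENNReal.ofReal κ * ENNReal.ofReal m := by
          refine Finset.sum_le_sum fun i _ => ?_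
          rw [lintegral_const_mul' _ _ ENNReal.ofReal_ne_top]
          gcongr
          exact lintegral_pow_abs_le (hmeas i) (hsub i) M
      _ = ENNReal.ofReal (n * (κ * m)) := by
          rw [Finset.sum_const, Finset.card_univ, Fintype.card_fin, nsmul_eq_mul,
            ENNReal.ofReal_mul hn'.le, ENNReal.ofReal_mul hκ0, ENNReal.ofReal_natCast]
      _ ≤ _ := by
          refine ENNReal.ofReal_le_ofReal ?_
          have h1 : (n : ℝ) * (n : ℝ) ^ (-((M - r) / 4)) ≤ (n : ℝ) ^ (-(r / 2)) := by
            rw [mul_comm, ← Real.rpow_add_one hn'.ne']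
            exact Real.rpow_le_rpow_of_exponent_le hn1 (by linarith)
          calc n * (κ * m) = B ^ r * m * (n * (n : ℝ) ^ (-((M - r) / 4))) := by rw [hκ]; ring
            _ ≤ _ := by gcongr
  have hbint : ∫⁻ ω, bad.indicator (fun _ => ENNReal.ofReal (B ^ r * (n : ℝ) ^ (r / 4))) ω ∂P ≤
      ENNReal.ofReal (B ^ r * C * (n : ℝ) ^ (-(r / 2))) := by
    refine (lintegral_indicator_const_le _ _).trans ((mul_le_mul_right hbad _).trans ?_)
    rw [← ENNReal.ofReal_mul (by positivity)]
    refine ENNReal.ofReal_le_ofReal ?_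
    have h1 : (n : ℝ) ^ (r / 4) * (n : ℝ) ^ (-(1 + 3 * r / 4)) ≤ (n : ℝ) ^ (-(r / 2)) := by
      rw [← Real.rpow_add hn']
      exact Real.rpow_le_rpow_of_exponent_le hn1 (by linarith)
    calc B ^ r * (n : ℝ) ^ (r / 4) * (C * (n : ℝ) ^ (-(1 + 3 * r / 4)))
        = B ^ r * C * ((n : ℝ) ^ (r / 4) * (n : ℝ) ^ (-(1 + 3 * r / 4))) := by ring
      _ ≤ _ := by gcongr
  calc ∫⁻ ω, err ω ^ r ∂P ≤ ∫⁻ ω, (ENNReal.ofReal (A ^ r) +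
        (Z ω + bad.indicator (fun _ => ENNReal.ofReal (B ^ r * (n : ℝ) ^ (r / 4))) ω)) ∂P :=
        lintegral_mono_ae hpt
    _ = ENNReal.ofReal (A ^ r) + (∫⁻ ω, Z ω ∂P +
        ∫⁻ ω, bad.indicator (fun _ => ENNReal.ofReal (B ^ r * (n : ℝ) ^ (r / 4))) ω ∂P) := by
        rw [lintegral_add_left measurable_const, lintegral_add_left hZm, lintegral_const,
          measure_univ, mul_one]
    _ ≤ ENNReal.ofReal (A ^ r) + (ENNReal.ofReal (B ^ r * m * (n : ℝ) ^ (-(r / 2))) +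
        ENNReal.ofReal (B ^ r * C * (n : ℝ) ^ (-(r / 2)))) := by gcongr
    _ = _ := by
        rw [← ENNReal.ofReal_add (by positivity) (by positivity),
          ← ENNReal.ofReal_add (by positivity) (by positivity)]
        congr 1; ring

lemma hasSubgaussianMGF_mono {Ω : Type*} [MeasurableSpace Ω] {P : Measure Ω} {X : Ω → ℝ}
    {τ τ' : ℝ≥0} (h : HasSubgaussianMGF X τ P) (hle : τ ≤ τ') : HasSubgaussianMGF X τ' P where
  integrable_exp_mul := h.integrable_exp_mul
  mgf_le z := (h.mgf_le z).trans (Real.exp_le_exp.2 (by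
    have : (τ : ℝ) ≤ τ' := hle
    gcongr))

lemma ofReal_mul_iSup_le {ι : Type*} {s : Set ι} {F : ι → ℝ≥0∞} {R Q : ℝ} (hR : 0 < R)
    (h : ∀ f ∈ s, F f ≤ ENNReal.ofReal (Q / R)) :
    ENNReal.ofReal R * ⨆ f ∈ s, F f ≤ ENNReal.ofReal Q := by
  calc ENNReal.ofReal R * ⨆ f ∈ s, F f ≤ ENNReal.ofReal R * ENNReal.ofReal (Q / R) := by
        gcongr; exact iSup₂_le h
    _ = ENNReal.ofReal Q := by
        rw [← ENNReal.ofReal_mul hR.le, mul_div_cancel₀ _ hR.ne']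

end MultiscaleSeg

theorem theorem2 {Ω : Type*} [MeasurableSpace Ω] (P : Measure Ω) [IsProbabilityMeasure P]
    -- the noise: independent, sub-Gaussian with scale `σ`, for every sample size
    (σ : ℝ≥0) (ξ : (n : ℕ) → Fin n → Ω → ℝ)
    (hξmeas : ∀ n i, Measurable (ξ n i))
    (hξindep : ∀ n, iIndepFun (ξ n) P)
    (hξsub : ∀ n i, HasSubgaussianMGF (ξ n i) (σ ^ 2) P)
    (p r : ℝ) (hp : 0 < p) (hr : 0 < r)
    (c δ a : ℝ) (hc : 1 < c) (hδ : 0 < δ) (ha : δ + σ * √(2 * r + 4) < a)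
    (𝓘 : ℕ → Set (ℝ × ℝ)) (h𝓘 : ∀ᶠ n in atTop, MultiscaleSeg.IsNormalSystem c n (𝓘 n))
    -- scale penalties and estimator: they may depend on the data and on further randomness
    (s : (n : ℕ) → (Fin n → ℝ) → Ω → ℝ × ℝ → (ℝ → ℝ) → ℝ)
    (fhat : (n : ℕ) → (Fin n → ℝ) → Ω → ℝ → ℝ)
    (γ L : ℝ) (hγ : 0 < γ) (hL : 0 < L) (q : ℝ≥0∞) (hq : ENNReal.ofReal (max p 2) ≤ q) :
    -- the risk: the estimator solves its problem almost surely under every truth of the class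
    ((∀ᶠ n in atTop, ∀ f ∈ MultiscaleSeg.approxClass γ q L, ∀ᵐ ω ∂P,
        MultiscaleSeg.IsSegmentation (𝓘 n)
          (s n (MultiscaleSeg.observations n f fun i => ξ n i ω) ω) δ (a * √(Real.log n))
          (MultiscaleSeg.observations n f fun i => ξ n i ω)
          (fhat n (MultiscaleSeg.observations n f fun i => ξ n i ω) ω)) →
      limsup (fun n : ℕ => ENNReal.ofReal (MultiscaleSeg.invRate γ p n) *
        ⨆ f ∈ MultiscaleSeg.approxClass γ q L,
          (∫⁻ ω, MultiscaleSeg.lpNorm (fun x =>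
            fhat n (MultiscaleSeg.observations n f fun i => ξ n i ω) ω x - f x)
            (ENNReal.ofReal p) ^ r ∂P) ^ (1 / r)) atTop < ∞) ∧
    -- almost surely, without the expectation: the exceptional null set is common to all truths
    ((∀ᶠ n in atTop, ∀ᵐ ω ∂P, ∀ f ∈ MultiscaleSeg.approxClass γ q L,
        MultiscaleSeg.IsSegmentation (𝓘 n)
          (s n (MultiscaleSeg.observations n f fun i => ξ n i ω) ω) δ (a * √(Real.log n))
          (MultiscaleSeg.observations n f fun i => ξ n i ω)
          (fhat n (MultiscaleSeg.observations n f fun i => ξ n i ω) ω)) →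
      ∀ᵐ ω ∂P, limsup (fun n : ℕ => ENNReal.ofReal (MultiscaleSeg.invRate γ p n) *
        ⨆ f ∈ MultiscaleSeg.approxClass γ q L,
          MultiscaleSeg.lpNorm (fun x =>
            fhat n (MultiscaleSeg.observations n f fun i => ξ n i ω) ω x - f x)
            (ENNReal.ofReal p)) atTop < ∞) := by
  classical
  have hL0 := hL.le
  have hq2 : 2 ≤ q := by
    refine le_trans ?_ hq
    rw [show (2 : ℝ≥0∞) = ENNReal.ofReal 2 by simp]
    exact ENNReal.ofReal_le_ofReal (le_max_right _ _)
  -- a level `t` for the noise and a positive variance proxy `τ ≥ σ²`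
  obtain ⟨t, ht1, ht2⟩ := exists_between (show σ * √(2 * r + 4) < a - δ by linarith)
  have ht0 : 0 < t := lt_of_le_of_lt (by positivity) ht1
  have ha0 : 0 ≤ a := by linarith
  have hr4 : 0 < 2 * r + 4 := by linarith
  have hσt : ((σ ^ 2 : ℝ≥0) : ℝ) < t ^ 2 / (2 * r + 4) := by
    rw [lt_div_iff₀ hr4, NNReal.coe_pow]
    calc (σ : ℝ) ^ 2 * (2 * r + 4) = (σ * √(2 * r + 4)) ^ 2 := by
          rw [mul_pow, Real.sq_sqrt hr4.le]
      _ < t ^ 2 := by gcongr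
  obtain ⟨τ', hτ1, hτ2⟩ := exists_between hσt
  have hτ'0 : 0 < τ' := lt_of_le_of_lt (NNReal.coe_nonneg _) hτ1
  lift τ' to ℝ≥0 using hτ'0.le with τ
  have hτ0 : 0 < τ := by exact_mod_cast hτ'0
  have hsub : ∀ n i, HasSubgaussianMGF (ξ n i) τ P := fun n i =>
    MultiscaleSeg.hasSubgaussianMGF_mono (hξsub n i) (NNReal.coe_lt_coe.1 hτ1).le
  obtain ⟨C, hC, htail⟩ := MultiscaleSeg.exists_tail_bound hξmeas hξindep hτ0 hsub ht0.le hr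
    (by rwa [lt_div_iff₀ hr4] at hτ2)
  obtain ⟨K, hK, herr⟩ := MultiscaleSeg.exists_error_bound (q := q) hγ hL hq2 hc ht0 hδ
    (show δ + t < a by linarith)
  -- the rate, uniformly over the class, on the event of bounded noise
  have hgood : ∀ᶠ n : ℕ in atTop, ∀ f ∈ MultiscaleSeg.approxClass γ q L, ∀ ω,
      MultiscaleSeg.IsSegmentation (𝓘 n)
        (s n (MultiscaleSeg.observations n f fun i => ξ n i ω) ω) δ (a * √(Real.log n))
        (MultiscaleSeg.observations n f fun i => ξ n i ω)
        (fhat n (MultiscaleSeg.observations n f fun i => ξ n i ω) ω) →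
      MultiscaleSeg.NoiseBounded (fun i => ξ n i ω) (t * √(Real.log n)) →
      MultiscaleSeg.lpNorm (fun x =>
        fhat n (MultiscaleSeg.observations n f fun i => ξ n i ω) ω x - f x)
        (ENNReal.ofReal p) ≤ ENNReal.ofReal (K / MultiscaleSeg.invRate γ p n) := by
    filter_upwards [herr, h𝓘, MultiscaleSeg.eventually_le_log 1] with n herr h𝓘 hlog f hf ω hseg hξ
    obtain ⟨h1, h2⟩ := herr _ h𝓘 f hf _ _ _ hseg hξ
    refine MultiscaleSeg.invRate_mul_lpNorm_le hγ hp hK hlog ?_ h1 h2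
    exact (MultiscaleSeg.aemeasurable_of_rightCont
      hseg.2.1.1.1.continuousWithinAt).aestronglyMeasurable.sub
      (MultiscaleSeg.aestronglyMeasurable_of_mem_approxClass hf)
  refine ⟨fun hseg => ?_, fun hseg => ?_⟩
  · obtain ⟨M, hM⟩ := exists_nat_ge (3 * r + 4)
    set B := 2 * L + 1 + 2 * (a + δ) with hB
    have hB0 : 0 ≤ B := by positivity
    set Q := K ^ r + B ^ r * (M.factorial * (2 * Real.exp (τ / 2)) + C) with hQ
    have hQ0 : 0 ≤ Q := by positivity
    refine (limsup_le_of_le (a := ENNReal.ofReal (Q ^ (1 / r))) (by isBoundedDefault) ?_).trans_lt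
      ENNReal.ofReal_lt_top
    filter_upwards [hgood, hseg, h𝓘, MultiscaleSeg.eventually_le_log 1] with n hgood hseg h𝓘 hlog
    have hn := MultiscaleSeg.pos_of_one_le_log hlog
    have hn' : (0 : ℝ) < n := by exact_mod_cast hn
    have hR := MultiscaleSeg.invRate_pos (γ := γ) (p := p) hlog
    have hRle := MultiscaleSeg.invRate_le (γ := γ) (p := p) hγ hlog
    set R := MultiscaleSeg.invRate γ p n with hRdef
    refine MultiscaleSeg.ofReal_mul_iSup_le hR fun f hf => ?_
    have hfb := MultiscaleSeg.ae_abs_le_of_mem_approxClass hL0 hf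
    have hmain := MultiscaleSeg.lintegral_rpow_le hn (hξmeas n) (hsub n) hr
      (A := K / R) (by positivity) hB0 hC (htail n hn)
      (err := fun ω => MultiscaleSeg.lpNorm (fun x =>
        fhat n (MultiscaleSeg.observations n f fun i => ξ n i ω) ω x - f x) (ENNReal.ofReal p))
      (by
        filter_upwards [hseg f hf] with ω hω hnb
        exact hgood f hf ω hω (not_not.1 hnb))
      (by
        filter_upwards [hseg f hf] with ω hω y hy hny
        exact hω.lpNorm_le hn h𝓘 hδ.le ha0 hL0 hfb _ hy hny) hM
    have hrate : (n : ℝ) ^ (-(r / 2)) ≤ (1 / R) ^ r := by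
      have h1 : R ^ r ≤ (n : ℝ) ^ (r / 2) := by
        calc R ^ r ≤ ((n : ℝ) ^ (1 / 2 : ℝ)) ^ r := by gcongr
          _ = (n : ℝ) ^ (r / 2) := by rw [← Real.rpow_mul hn'.le]; congr 1; ring
      rw [Real.rpow_neg hn'.le, one_div, Real.inv_rpow hR.le]
      exact inv_anti₀ (by positivity) h1
    have hfinal : (K / R) ^ r + B ^ r * (M.factorial * (2 * Real.exp (τ / 2)) + C) *
        (n : ℝ) ^ (-(r / 2)) ≤ (Q ^ (1 / r) / R) ^ r := by
      calc (K / R) ^ r + B ^ r * (M.factorial * (2 * Real.exp (τ / 2)) + C) *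
            (n : ℝ) ^ (-(r / 2))
          ≤ K ^ r * (1 / R) ^ r + B ^ r * (M.factorial * (2 * Real.exp (τ / 2)) + C) *
            (1 / R) ^ r := by
            rw [← Real.mul_rpow (by positivity) (by positivity), mul_one_div]
            gcongr
        _ = Q * (1 / R) ^ r := by rw [hQ]; ring
        _ = (Q ^ (1 / r) / R) ^ r := by
            rw [div_eq_mul_one_div (Q ^ (1 / r)), Real.mul_rpow (by positivity) (by positivity),
              ← Real.rpow_mul hQ0, one_div_mul_cancel hr.ne', Real.rpow_one]
    calc _ ≤ (ENNReal.ofReal ((Q ^ (1 / r) / R) ^ r)) ^ (1 / r) :=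
          ENNReal.rpow_le_rpow (hmain.trans (ENNReal.ofReal_le_ofReal hfinal)) (by positivity)
      _ = ENNReal.ofReal (Q ^ (1 / r) / R) := by
          rw [ENNReal.ofReal_rpow_of_nonneg (by positivity) (by positivity),
            ← Real.rpow_mul (by positivity), mul_one_div_cancel hr.ne', Real.rpow_one]
  -- the exceptional probabilities are summable, so that almost surely the noise is bounded for all
  -- large `n`
  · have hsum : ∑' n : ℕ, P {ω | ¬ MultiscaleSeg.NoiseBounded (fun i => ξ (n + 1) i ω)
        (t * √(Real.log ((n + 1 : ℕ) : ℝ)))} ≠ ∞ := by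
      have hs : Summable fun n : ℕ => C * (((n + 1 : ℕ) : ℝ)) ^ (-(1 + 3 * r / 4)) :=
        ((summable_nat_add_iff 1).2 (Real.summable_nat_rpow.2 (by linarith))).mul_left C
      refine ne_top_of_le_ne_top hs.tsum_ofReal_ne_top
        (ENNReal.tsum_le_tsum fun n => htail (n + 1) n.succ_pos)
    have hev : ∀ᵐ ω ∂P, ∀ᶠ n : ℕ in atTop,
        MultiscaleSeg.NoiseBounded (fun i => ξ n i ω) (t * √(Real.log n)) := by
      filter_upwards [ae_eventually_notMem hsum] with ω hω
      rw [← map_add_atTop_eq_nat 1, eventually_map]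
      filter_upwards [hω] with n hn
      exact not_not.1 hn
    obtain ⟨N, hN⟩ := eventually_atTop.1 hseg
    have hall : ∀ᵐ ω ∂P, ∀ n, N ≤ n → ∀ f ∈ MultiscaleSeg.approxClass γ q L,
        MultiscaleSeg.IsSegmentation (𝓘 n)
          (s n (MultiscaleSeg.observations n f fun i => ξ n i ω) ω) δ (a * √(Real.log n))
          (MultiscaleSeg.observations n f fun i => ξ n i ω)
          (fhat n (MultiscaleSeg.observations n f fun i => ξ n i ω) ω) :=
      ae_all_iff.2 fun n => by
        by_cases h : N ≤ n
        · filter_upwards [hN n h] with ω hω _ using hω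
        · exact Eventually.of_forall fun ω h' => absurd h' h
    filter_upwards [hev, hall] with ω hω1 hω2
    refine (limsup_le_of_le (a := ENNReal.ofReal K) (by isBoundedDefault) ?_).trans_lt
      ENNReal.ofReal_lt_top
    filter_upwards [hgood, hω1, eventually_ge_atTop N, MultiscaleSeg.eventually_le_log 1]
      with n hgood hnb hNn hlog
    exact MultiscaleSeg.ofReal_mul_iSup_le (MultiscaleSeg.invRate_pos hlog) fun f hf =>
      hgood f hf ω (hω2 n hNn f hf) hnb
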